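/- Let $n\ge 2$, $m,\sigma>0$, $\rho=2\sigma$, $\epsilon=\sigma/(\sigma-\rho)=-1$, $D=m\rho^2$ and $A=\mathrm{diag}(a_1,\dots,a_n)$ with all $a_i>0$. Write $(\cdot,\cdot)$ for the Euclidean scalar product, $E_1,\dots,E_n$ for the standard basis of $\mathbb R^n$, and $X\wedge Y=XY^T-YX^T\in so(n)$. Consider a spherical shell of radius $\rho$ and mass $m$ rolling without slipping and twisting over a fixed sphere $S^{n-1}$ of radius $\sigma$ placed inside it, with inertia operator $\mathbb I:so(n)\to so(n)$ given by $\mathbb I(E_i\wedge E_j)=(a_ia_j-D)\,E_i\wedge E_j$, so that $\mathbf I=\mathbb I+D\,\mathrm{Id}$ satisfies $\mathbf I(X\wedge Y)=AX\wedge AY$. The reduced system is the system on $TS^{n-1}$, $S^{n-1}=\{(\gamma,\gamma)=1\}$, whose motions are the $C^2$ curves $\gamma(t)$ on $S^{n-1}$, defined on open intervals, with $$\Big(\epsilon\frac{d}{dt}\big(\mathbf I(\gamma\wedge\dot\gamma)\gamma\big)+(1-\epsilon)\mathbf I(\gamma\wedge\dot\gamma)\dot\gamma,\ \xi\Big)=0\qquad\text{for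 all }\xi\in T_\gamma S^{n-1},$$ and its kinetic energy is $\frac12\langle\dot\gamma,\dot\gamma\rangle_0$, where $\langle X,Y\rangle_0=-\epsilon^{-2}(\mathbf I(\gamma\wedge X)\gamma,Y)$ for $X,Y\in T_\gamma S^{n-1}$. Then: 1. A $C^2$ curve $\gamma(t)$ on $S^{n-1}$, defined on an open interval, is a motion of the reduced system if and only if, for some Lagrange multiplier $\lambda(t)$, $$\epsilon\frac{d}{dt}\big((A\gamma,\dot\gamma)A\gamma-(A\gamma,\gamma)A\dot\gamma\big)=(\epsilon-1)\big((A\dot\gamma,\dot\gamma)A\gamma-(A\gamma,\dot\gamma)A\dot\gamma\big)+\lambda\gamma .\qquad(*)$$ 2. The reduced system is completely integrable: there is a smooth nowhere vanishing function $\nu$ on $S^{n-1}$ such that in the time $d\tau=\nu(\gamma)\,dt$ the system becomes the geodesic flow of the metric $g_*=\nu^2\langle\cdot,\cdot\rangle_0$, that is, with momentum $p=g_*(\gamma')$ (where $\gamma'=d\gamma/d\tau$) it is the Hamiltonian system on $T^*S^{n-1}$ with Hamiltonian $H=\frac12\langle\gamma',\gamma'\rangle_*=\frac12\langle\dot\gamma,\dot\gamma\rangle_0$;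 and $H$ is Liouville integrable, i.e. it has $n-1$ smooth first integrals on $T^*S^{n-1}$ that are pairwise in involution with respect to the canonical Poisson bracket and functionally independent on an open dense subset. 3. Let $\gamma(t)$ be a solution of $(*)$ on $S^{n-1}$, defined on an open interval, with $\frac12\langle\dot\gamma,\dot\gamma\rangle_0=1$. Then under the transformation $x=A^{1/2}\gamma/\sqrt{(A\gamma,\gamma)}$ and the time reparametrisation $ds=-(A^{-1}x,x)^{1/2}\,dt$ it is mapped to a zero-energy trajectory $x(s)$ of the Neumann system on the sphere $(x,x)=1$, i.e. a trajectory of the natural mechanical system with Lagrangian $$L_{-1}=\frac12\Big(\frac{dx}{ds},\frac{dx}{ds}\Big)+(A^{-1}x,x),$$ with $\frac12\big(\frac{dx}{ds},\frac{dx}{ds}\big)-(A^{-1}x,x)=0$. -/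

import Mathlib

open scoped ContDiff InnerProductSpace

noncomputable section

namespace RubberBall

/-- Euclidean space `ℝⁿ`. -/
abbrev E (n : ℕ) : Type := EuclideanSpace ℝ (Fin n)

/-- The Lie algebra `so(n)` of skew-symmetric matrices. -/
abbrev so (n : ℕ) : Type := LieAlgebra.Orthogonal.so (Fin n) ℝ

/-- `X ∧ Y = X Yᵀ - Y Xᵀ`. -/
def wedge {n : ℕ} (X Y : E n) : so n :=
  ⟨Matrix.vecMulVec X.ofLp Y.ofLp - Matrix.vecMulVec Y.ofLp X.ofLp, by
    rw [LieAlgebra.Orthogonal.mem_so, Matrix.transpose_sub, Matrix.transpose_vecMulVec,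
      Matrix.transpose_vecMulVec, neg_sub]⟩

/-- The matrix `W ∈ so(n)` applied to a vector. -/
def act {n : ℕ} (W : so n) (X : E n) : E n :=
  Matrix.toEuclideanLin (W : Matrix (Fin n) (Fin n) ℝ) X

/-- The standard basis vectors. -/
def basisVec {n : ℕ} (i : Fin n) : E n := EuclideanSpace.single i 1

/-- The diagonal matrix with entries `c i`, applied to a vector. -/
def diagMul {n : ℕ} (c : Fin n → ℝ) (X : E n) : E n := WithLp.toLp 2 fun i => c i * X i

/-- A `C²` curve on the unit sphere, parametrised by the open interval `I`
(values outside `I` are irrelevant). -/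
structure IsSphereCurve {n : ℕ} (γ : ℝ → E n) (I : Set ℝ) : Prop where
  isOpen : IsOpen I
  ordConnected : I.OrdConnected
  contDiffOn : ContDiffOn ℝ 2 γ I
  norm_eq_one : ∀ t ∈ I, ‖γ t‖ = 1

/-! ### The reduced rubber Chaplygin ball -/

/-- `ε = σ / (σ - ρ)`, for a ball of radius `ρ` and a fixed sphere of radius `σ` one of which
lies inside the other; for `σ < ρ` the fixed sphere is inside the rolling spherical shell. -/
def radiiRatio (σ ρ : ℝ) : ℝ := σ / (σ - ρ)

/-- `𝐈 = 𝕀 + D Id` with `D = m ρ²`, where `𝕀` is the inertia operator of the ball. -/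
def totalInertia {n : ℕ} (m ρ : ℝ) (J : so n →ₗ[ℝ] so n) : so n →ₗ[ℝ] so n :=
  J + (m * ρ ^ 2) • LinearMap.id

/-- The reduced metric `g₀` as a map `T_γ S → T*_γ S ≅ γ^⊥`,
`X ↦ -ε⁻² 𝐈(γ ∧ X) γ` (orthogonal to `γ` by skew-symmetry). -/
def reducedFlat {n : ℕ} (ε : ℝ) (I₀ : so n →ₗ[ℝ] so n) (γ X : E n) : E n :=
  -(1 / ε ^ 2) • act (I₀ (wedge γ X)) γ

/-- The reduced metric `⟨X, Y⟩₀ = -ε⁻² (𝐈(γ ∧ X) γ, Y)` at `γ`. -/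
def reducedMetric {n : ℕ} (ε : ℝ) (I₀ : so n →ₗ[ℝ] so n) (γ X Y : E n) : ℝ :=
  ⟪reducedFlat ε I₀ γ X, Y⟫_ℝ

/-- Motions of the reduced system: curves on the sphere with
`(ε d/dt (𝐈(γ ∧ γ̇) γ) + (1 - ε) 𝐈(γ ∧ γ̇) γ̇, ξ) = 0` for all `ξ` tangent to the sphere at `γ`. -/
structure IsReducedMotion {n : ℕ} (ε : ℝ) (I₀ : so n →ₗ[ℝ] so n) (γ : ℝ → E n) (I : Set ℝ) :
    Prop extends IsSphereCurve γ I where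
  eq_motion : ∀ t ∈ I, ∀ ξ : E n, ⟪γ t, ξ⟫_ℝ = 0 →
    ⟪ε • deriv (fun τ => act (I₀ (wedge (γ τ) (deriv γ τ))) (γ τ)) t
      + (1 - ε) • act (I₀ (wedge (γ t) (deriv γ t))) (deriv γ t), ξ⟫_ℝ = 0

/-- Curves on the sphere satisfying, for `A = diag(a)` and some Lagrange multiplier `lam`,
`ε d/dt ((Aγ, γ̇) Aγ - (Aγ, γ) Aγ̇) = (ε - 1) ((Aγ̇, γ̇) Aγ - (Aγ, γ̇) Aγ̇) + lam γ`. -/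
structure IsSpecialMotion {n : ℕ} (ε : ℝ) (a : Fin n → ℝ) (γ : ℝ → E n) (I : Set ℝ) :
    Prop extends IsSphereCurve γ I where
  eq_motion : ∃ lam : ℝ → ℝ, ∀ t ∈ I,
    ε • deriv (fun τ => ⟪diagMul a (γ τ), deriv γ τ⟫_ℝ • diagMul a (γ τ)
        - ⟪diagMul a (γ τ), γ τ⟫_ℝ • diagMul a (deriv γ τ)) t
      = (ε - 1) • (⟪diagMul a (deriv γ t), deriv γ t⟫_ℝ • diagMul a (γ t)
        - ⟪diagMul a (γ t), deriv γ t⟫_ℝ • diagMul a (deriv γ t)) + lam t • γ t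

/-! ### The cotangent bundle of the sphere and complete integrability -/

/-- `T*S^{n-1}`, realised as `{(x, p) : |x| = 1, (x, p) = 0}`. -/
def cotangentSphere (n : ℕ) : Set (E n × E n) := {z | ‖z.1‖ = 1 ∧ ⟪z.1, z.2⟫_ℝ = 0}

/-- The tangent space of `T*S^{n-1}` at `z = (x, p)`. -/
def tangent {n : ℕ} (z : E n × E n) : Submodule ℝ (E n × E n) where
  carrier := {ζ | ⟪z.1, ζ.1⟫_ℝ = 0 ∧ ⟪z.1, ζ.2⟫_ℝ + ⟪z.2, ζ.1⟫_ℝ = 0}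
  add_mem' := by
    rintro u v ⟨h1, h2⟩ ⟨h3, h4⟩
    simp only [Set.mem_ofPred_eq, Prod.fst_add, Prod.snd_add, inner_add_right]
    constructor <;> linarith
  zero_mem' := by simp
  smul_mem' := by
    rintro c u ⟨h1, h2⟩
    simp only [Set.mem_ofPred_eq, Prod.smul_fst, Prod.smul_snd, inner_smul_right]
    exact ⟨by rw [h1, mul_zero], by rw [← mul_add, h2, mul_zero]⟩

/-- The canonical symplectic form `∑ dxᵢ ∧ dpᵢ`, to be restricted to `T*S^{n-1}`. -/
def symplecticForm {n : ℕ} (ζ η : E n × E n) : ℝ := ⟪ζ.1, η.2⟫_ℝ - ⟪ζ.2, η.1⟫_ℝ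

/-- `ζ` is the value at `z` of the Hamiltonian vector field of `f` on `T*S^{n-1}`. -/
def IsHamiltonianVector {n : ℕ} (f : E n × E n → ℝ) (z ζ : E n × E n) : Prop :=
  ζ ∈ tangent z ∧ ∀ η ∈ tangent z, symplecticForm ζ η = fderiv ℝ f z η

/-- The Poisson bracket of `f` and `g` on `T*S^{n-1}` vanishes identically. -/
def InInvolution {n : ℕ} (f g : E n × E n → ℝ) : Prop :=
  ∀ z ∈ cotangentSphere n, ∀ ζ ζ' : E n × E n,
    IsHamiltonianVector f z ζ → IsHamiltonianVector g z ζ' → symplecticForm ζ ζ' = 0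

/-- The differentials of the functions `f i` on `T*S^{n-1}` are linearly independent
at the points of a dense (and automatically open) subset. -/
def FunctionallyIndependent {n k : ℕ} (f : Fin k → E n × E n → ℝ) : Prop :=
  cotangentSphere n ⊆ closure {z | z ∈ cotangentSphere n ∧
    LinearIndependent ℝ fun i =>
      ((fderiv ℝ (f i) z : E n × E n →L[ℝ] ℝ) : E n × E n →ₗ[ℝ] ℝ).domRestrict (tangent z)}

/-- Liouville integrability of the Hamiltonian `H` on `T*S^{n-1}`: there are `n - 1` smooth first
integrals of `H`, pairwise in involution and functionally independent. (Smooth functions on the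
closed submanifold `T*S^{n-1}` are the restrictions of smooth functions on `ℝⁿ × ℝⁿ`.) -/
def LiouvilleIntegrable {n : ℕ} (H : E n × E n → ℝ) : Prop :=
  ∃ f : Fin (n - 1) → E n × E n → ℝ, (∀ i, ContDiff ℝ ∞ (f i)) ∧
    (∀ i, InInvolution H (f i)) ∧ (∀ i j, InInvolution (f i) (f j)) ∧ FunctionallyIndependent f

/-- `ν` is a Chaplygin multiplier of the reduced system, and `H` the resulting Hamiltonian: in the
time `dτ = ν(γ) dt` the system is the Hamiltonian form of the geodesic flow of `g_* = ν² g₀`.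
Since `γ' = γ̇ / ν`, the momentum is `p = g_*(γ') = ν g₀(γ̇)` and
`H(γ, p) = ½⟨γ', γ'⟩_* = ½⟨γ̇, γ̇⟩₀`. -/
structure IsHamiltonization {n : ℕ} (ε : ℝ) (I₀ : so n →ₗ[ℝ] so n)
    (ν : E n → ℝ) (H : E n × E n → ℝ) : Prop where
  smooth_multiplier : ContDiffOn ℝ ∞ ν {0}ᶜ
  multiplier_ne_zero : ∀ γ : E n, ‖γ‖ = 1 → ν γ ≠ 0
  smooth_hamiltonian : ContDiff ℝ ∞ H
  legendre : ∀ γ X : E n, ‖γ‖ = 1 → ⟪γ, X⟫_ℝ = 0 →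
    H (γ, ν γ • reducedFlat ε I₀ γ X) = 1 / 2 * reducedMetric ε I₀ γ X X
  motion_iff : ∀ (γ : ℝ → E n) (I : Set ℝ), IsSphereCurve γ I →
    (IsReducedMotion ε I₀ γ I ↔ ∀ t ∈ I,
      IsHamiltonianVector H (γ t, ν (γ t) • reducedFlat ε I₀ (γ t) (deriv γ t))
        ((ν (γ t))⁻¹ •
          deriv (fun τ => (γ τ, ν (γ τ) • reducedFlat ε I₀ (γ τ) (deriv γ τ))) t))

/-- Complete integrability of the reduced system: after a Chaplygin time reparametrisation it is a
Liouville integrable Hamiltonian system on `T*S^{n-1}`. -/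
def CompletelyIntegrable {n : ℕ} (ε : ℝ) (I₀ : so n →ₗ[ℝ] so n) : Prop :=
  ∃ (ν : E n → ℝ) (H : E n × E n → ℝ), IsHamiltonization ε I₀ ν H ∧ LiouvilleIntegrable H

/-! ### The Neumann system -/

/-- The map `γ ↦ A^{1/2} γ / √(Aγ, γ)`, `A = diag(a)`. -/
def sphereMap {n : ℕ} (a : Fin n → ℝ) (γ : E n) : E n :=
  (√⟪diagMul a γ, γ⟫_ℝ)⁻¹ • diagMul (fun i => √(a i)) γ

/-- The quadratic form `(A⁻¹x, x)`, `A = diag(a)`. -/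
def invForm {n : ℕ} (a : Fin n → ℝ) (x : E n) : ℝ := ⟪diagMul (fun i => (a i)⁻¹) x, x⟫_ℝ

/-- The Neumann potential `V(x) = -(A⁻¹x, x)`. -/
def neumannPotential {n : ℕ} (a : Fin n → ℝ) (x : E n) : ℝ := -invForm a x

/-- Trajectories of the natural mechanical system on the unit sphere with Lagrangian
`½ (x', x') - V(x)`: the vector `x'' + grad V(x)` is normal to the sphere. -/
structure IsNaturalTrajectory {n : ℕ} (V : E n → ℝ) (x : ℝ → E n) (I : Set ℝ) :
    Prop extends IsSphereCurve x I where
  eq_motion : ∀ s ∈ I, ∀ ξ : E n, ⟪x s, ξ⟫_ℝ = 0 →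
    ⟪deriv (deriv x) s + gradient V (x s), ξ⟫_ℝ = 0

end RubberBall

end

/-!
For `ε = -1` everything can be computed explicitly. Write `N = (Aγ, γ)`. The map
`γ ↦ x = A^{1/2} γ / √N` carries the reduced metric `g₀` to `N²` times the round metric, and with the
multiplier `ν = N^{-3/2}` the metric `g_* = ν² g₀` becomes `(A⁻¹x, x)` times the round metric, which
is the Jacobi metric of the Neumann system at zero energy. Accordingly `ν` is a Chaplygin multiplier
(`isHamiltonization_hamiltonian`), with Hamiltonian `H = ½ N² (A⁻¹p, p)` on `T*S^{n-1}`, and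
solutions of energy one are, up to a change of time, zero-energy Neumann trajectories
(`IsSpecialMotion.neumann`). The special form of the equations is the identity
`𝐈 (X ∧ Y) = AX ∧ AY` for all vectors (`totalInertia_wedge`).

For the integrability of `H`, use the canonical coordinates `u = A^{1/2} γ`, `v = A^{-1/2} p` of
`T*ℝⁿ`, the angular momenta `Lᵢⱼ = uᵢ vⱼ - uⱼ vᵢ`, and the functions
`½ ∑ Wᵢⱼ Lᵢⱼ² - (∑ bᵢ uᵢ²) (½ ∑ Lᵢⱼ²)` with weights subject to `(1/aᵢ - 1/aⱼ) Wᵢⱼ = bᵢ - bⱼ`. They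
are the integrals of the Neumann system in which the coupling constant is replaced by `H`; the
Hamiltonian itself is the member `W = 0`, `b = -½`. Two of them are in involution whenever `W` and
the weights of the other function satisfy Manakov's condition (`inInvolution_quadIntegral`), which
is a condition on triples of indices with equal `aᵢ` only. If the `aᵢ` are distinct, taking for `b`
the indicators of the indices gives the classical Uhlenbeck integrals. If some of them coincide, the
indices fall into blocks; each block contributes one integral of this kind and the chain of Casimir
functions of the rotations of its first `2, 3, …` indices (`momWeight`, `posWeight`). Omitting the
first index leaves `n - 1` integrals.

The angular momenta are linear in `v`, so for fixed `γ` the fibre derivatives of the integrals are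
linear in the momentum. Over a point with nonzero coordinates they are independent at one suitable
momentum (`exists_linearIndependent_momGrad`), hence at all but finitely many points of every line in
the fibre parallel to it, and this gives independence on a dense set.
-/

noncomputable section

namespace RubberBall

variable {n : ℕ} {I₀ : so n →ₗ[ℝ] so n} {a : Fin n → ℝ}

/-! ### The inertia operator and the special form of the equations -/

@[simp] theorem diagMul_apply (c : Fin n → ℝ) (X : E n) (i : Fin n) :
    diagMul c X i = c i * X i := rfl

theorem inner_eq_sum (X Y : E n) : ⟪X, Y⟫_ℝ = ∑ i, X i * Y i := by
  simp [PiLp.inner_apply, mul_comm]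

theorem inner_diagMul_comm (c : Fin n → ℝ) (X Y : E n) :
    ⟪diagMul c X, Y⟫_ℝ = ⟪diagMul c Y, X⟫_ℝ := by
  simp only [inner_eq_sum, diagMul_apply]
  exact Finset.sum_congr rfl fun i _ => by ring

theorem wedge_eq_sum (X Y : E n) :
    wedge X Y = ∑ i, ∑ j, (X i * Y j) • wedge (basisVec (n := n) i) (basisVec j) := by
  ext k l
  simp only [wedge, basisVec, AddSubmonoidClass.coe_finsetSum, SetLike.val_smul, Matrix.sum_apply,
    Matrix.smul_apply, Matrix.sub_apply, Matrix.vecMulVec_apply, smul_eq_mul, mul_sub,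
    Finset.sum_sub_distrib]
  have h (p q : Fin n) : ∑ i, ∑ j, X i * Y j *
      ((EuclideanSpace.single i (1 : ℝ)).ofLp p * (EuclideanSpace.single j (1 : ℝ)).ofLp q)
      = X p * Y q := by
    simp
  rw [h k l]
  congr 1
  rw [mul_comm (Y k), ← h l k]
  exact Finset.sum_congr rfl fun i _ => Finset.sum_congr rfl fun j _ => by ring

theorem diagMul_wedge_basis (a : Fin n → ℝ) (X Y : E n) :
    wedge (diagMul a X) (diagMul a Y) = ∑ i, ∑ j, (a i * a j * (X i * Y j)) •
      wedge (basisVec (n := n) i) (basisVec j) := by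
  rw [wedge_eq_sum]
  refine Finset.sum_congr rfl fun i _ => Finset.sum_congr rfl fun j _ => ?_
  congr 1
  simp only [diagMul_apply]; ring

/-- `𝐈 (X ∧ Y) = AX ∧ AY` for all vectors, by bilinearity. -/
theorem totalInertia_wedge {m ρ : ℝ} {a : Fin n → ℝ} {J : so n →ₗ[ℝ] so n}
    (hJ : ∀ i j : Fin n, J (wedge (basisVec i) (basisVec j)) =
      (a i * a j - m * ρ ^ 2) • wedge (basisVec i) (basisVec j)) (X Y : E n) :
    totalInertia m ρ J (wedge X Y) = wedge (diagMul a X) (diagMul a Y) := by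
  rw [diagMul_wedge_basis, wedge_eq_sum]
  simp only [map_sum, map_smul]
  refine Finset.sum_congr rfl fun i _ => Finset.sum_congr rfl fun j _ => ?_
  simp only [totalInertia, LinearMap.add_apply, LinearMap.smul_apply, LinearMap.id_apply, hJ]
  rw [← add_smul, smul_smul]
  congr 1; ring

theorem act_wedge (X Y Z : E n) : act (wedge X Y) Z = ⟪Y, Z⟫_ℝ • X - ⟪X, Z⟫_ℝ • Y := by
  ext i
  simp only [act, wedge, inner_eq_sum, Matrix.toLpLin_apply, Matrix.mulVec, dotProduct,
    Matrix.sub_apply, Matrix.vecMulVec_apply, PiLp.sub_apply, PiLp.smul_apply, smul_eq_mul,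
    Finset.sum_mul, ← Finset.sum_sub_distrib]
  exact Finset.sum_congr rfl fun j _ => by ring

theorem act_inertia (hI : ∀ X Y : E n, I₀ (wedge X Y) = wedge (diagMul a X) (diagMul a Y))
    (γ X Z : E n) :
    act (I₀ (wedge γ X)) Z = ⟪diagMul a X, Z⟫_ℝ • diagMul a γ - ⟪diagMul a γ, Z⟫_ℝ • diagMul a X := by
  rw [hI, act_wedge]

/-- A vector is orthogonal to the tangent space of the sphere at `γ` iff it is normal. -/
theorem forall_inner_eq_zero_iff {γ V : E n} (hγ : ‖γ‖ = 1) :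
    (∀ ξ : E n, ⟪γ, ξ⟫_ℝ = 0 → ⟪V, ξ⟫_ℝ = 0) ↔ V = ⟪γ, V⟫_ℝ • γ := by
  have hγγ : ⟪γ, γ⟫_ℝ = 1 := by rw [real_inner_self_eq_norm_sq, hγ, one_pow]
  constructor
  · intro h
    have h1 : ⟪γ, V - ⟪γ, V⟫_ℝ • γ⟫_ℝ = 0 := by
      rw [inner_sub_right, inner_smul_right, hγγ]; ring
    have h2 : ⟪V - ⟪γ, V⟫_ℝ • γ, V - ⟪γ, V⟫_ℝ • γ⟫_ℝ = 0 := by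
      nth_rewrite 1 [inner_sub_left]
      rw [h _ h1, inner_smul_left, h1]; simp
    exact sub_eq_zero.1 (inner_self_eq_zero.1 h2)
  · intro h ξ hξ
    rw [h, inner_smul_left, hξ, mul_zero]

theorem isReducedMotion_iff_isSpecialMotion
    (hI : ∀ X Y : E n, I₀ (wedge X Y) = wedge (diagMul a X) (diagMul a Y))
    (ε : ℝ) (γ : ℝ → E n) (I : Set ℝ) :
    IsReducedMotion ε I₀ γ I ↔ IsSpecialMotion ε a γ I := by
  have hfun : (fun τ => act (I₀ (wedge (γ τ) (deriv γ τ))) (γ τ)) =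
      fun τ => ⟪diagMul a (γ τ), deriv γ τ⟫_ℝ • diagMul a (γ τ)
        - ⟪diagMul a (γ τ), γ τ⟫_ℝ • diagMul a (deriv γ τ) := by
    funext τ
    rw [act_inertia hI, inner_diagMul_comm a (deriv γ τ)]
  constructor
  · rintro ⟨hc, h⟩
    rw [hfun] at h
    simp only [act_inertia hI] at h
    have hex : ∀ t ∈ I, ∃ l : ℝ, _ = l • γ t := fun t ht =>
      ⟨_, (forall_inner_eq_zero_iff (hc.norm_eq_one t ht)).1 (h t ht)⟩
    choose! lam hlam using hex
    refine ⟨hc, lam, fun t ht => ?_⟩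
    rw [← hlam t ht]
    module
  · rintro ⟨hc, lam, h⟩
    refine ⟨hc, fun t ht ξ hξ => ?_⟩
    rw [hfun, h t ht, act_inertia hI]
    have : ∀ V : E n, (ε - 1) • V + lam t • γ t + (1 - ε) • V = lam t • γ t := by
      intro V; module
    rw [this, inner_smul_left, hξ, mul_zero]

/-! ### Calculus along curves on the sphere -/

/-- `diagMul c` as a continuous linear map. -/
def diagCLM (c : Fin n → ℝ) : E n →L[ℝ] E n :=
  LinearMap.toContinuousLinearMap
    { toFun := diagMul c
      map_add' := fun X Y => by ext i; simp [mul_add]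
      map_smul' := fun r X => by ext i; simp [mul_left_comm] }

@[simp] theorem diagCLM_apply (c : Fin n → ℝ) (X : E n) : diagCLM c X = diagMul c X := rfl

theorem contDiff_diagMul (c : Fin n → ℝ) {k : WithTop ℕ∞} : ContDiff ℝ k (diagMul (n := n) c) :=
  (diagCLM c).contDiff

theorem diagMul_smul (c : Fin n → ℝ) (r : ℝ) (X : E n) : diagMul c (r • X) = r • diagMul c X :=
  (diagCLM c).map_smul r X

theorem diagMul_sub (c : Fin n → ℝ) (X Y : E n) :
    diagMul c (X - Y) = diagMul c X - diagMul c Y :=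
  (diagCLM c).map_sub X Y

theorem _root_.HasDerivAt.diagMul {g : ℝ → E n} {g' : E n} {t : ℝ} (c : Fin n → ℝ)
    (h : HasDerivAt g g' t) :
    HasDerivAt (fun τ => RubberBall.diagMul c (g τ)) (RubberBall.diagMul c g') t :=
  (diagCLM c).hasFDerivAt.comp_hasDerivAt t h

theorem inner_diagMul_self_pos {c : Fin n → ℝ} (hc : ∀ i, 0 < c i) {γ : E n} (hγ : γ ≠ 0) :
    0 < ⟪diagMul c γ, γ⟫_ℝ := by
  obtain ⟨i, hi⟩ : ∃ i, γ i ≠ 0 := by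
    by_contra! h
    exact hγ (by ext i; simpa using h i)
  rw [inner_eq_sum]
  refine Finset.sum_pos' (fun j _ => ?_) ⟨i, Finset.mem_univ i, ?_⟩
  · rw [diagMul_apply, mul_assoc]; exact mul_nonneg (hc j).le (mul_self_nonneg _)
  · rw [diagMul_apply, mul_assoc]; exact mul_pos (hc i) (mul_self_pos.2 hi)

theorem ne_zero_of_norm_eq_one {γ : E n} (h : ‖γ‖ = 1) : γ ≠ 0 := by
  rintro rfl; simp at h

theorem IsSphereCurve.hasDerivAt {γ : ℝ → E n} {I : Set ℝ} (h : IsSphereCurve γ I) {t : ℝ}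
    (ht : t ∈ I) : HasDerivAt γ (deriv γ t) t :=
  ((h.contDiffOn.differentiableOn (by norm_num)).differentiableAt
    (h.isOpen.mem_nhds ht)).hasDerivAt

theorem IsSphereCurve.contDiffOn_deriv {γ : ℝ → E n} {I : Set ℝ} (h : IsSphereCurve γ I) :
    ContDiffOn ℝ 1 (deriv γ) I :=
  h.contDiffOn.deriv_of_isOpen h.isOpen (by norm_num)

theorem IsSphereCurve.hasDerivAt_deriv {γ : ℝ → E n} {I : Set ℝ} (h : IsSphereCurve γ I) {t : ℝ}
    (ht : t ∈ I) : HasDerivAt (deriv γ) (deriv (deriv γ) t) t :=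
  ((h.contDiffOn_deriv.differentiableOn (by norm_num)).differentiableAt
    (h.isOpen.mem_nhds ht)).hasDerivAt

theorem IsSphereCurve.inner_self {γ : ℝ → E n} {I : Set ℝ} (h : IsSphereCurve γ I) {t : ℝ}
    (ht : t ∈ I) : ⟪γ t, γ t⟫_ℝ = 1 := by
  rw [real_inner_self_eq_norm_sq, h.norm_eq_one t ht, one_pow]

theorem hasDerivAt_inner_eq_zero {f g : ℝ → E n} {f' g' : E n} {I : Set ℝ} {r t : ℝ}
    (hI : IsOpen I) (ht : t ∈ I) (hf : HasDerivAt f f' t) (hg : HasDerivAt g g' t)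
    (h : ∀ τ ∈ I, ⟪f τ, g τ⟫_ℝ = r) : ⟪f t, g'⟫_ℝ + ⟪f', g t⟫_ℝ = 0 := by
  have h1 := hf.inner ℝ hg
  have h2 : HasDerivAt (fun τ => ⟪f τ, g τ⟫_ℝ) 0 t :=
    (hasDerivAt_const t r).congr_of_eventuallyEq
      (Filter.eventually_of_mem (hI.mem_nhds ht) fun τ hτ => h τ hτ)
  exact h1.unique h2

theorem IsSphereCurve.inner_deriv {γ : ℝ → E n} {I : Set ℝ} (h : IsSphereCurve γ I) {t : ℝ}
    (ht : t ∈ I) : ⟪γ t, deriv γ t⟫_ℝ = 0 := by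
  have := hasDerivAt_inner_eq_zero h.isOpen ht (h.hasDerivAt ht) (h.hasDerivAt ht)
    fun τ hτ => h.inner_self hτ
  rw [real_inner_comm (γ t) (deriv γ t)] at this
  linarith

theorem hasDerivAt_quadForm {g : ℝ → E n} {g' : E n} {t : ℝ} (c : Fin n → ℝ)
    (h : HasDerivAt g g' t) :
    HasDerivAt (fun τ => ⟪diagMul c (g τ), g τ⟫_ℝ) (2 * ⟪diagMul c (g t), g'⟫_ℝ) t := by
  refine ((h.diagMul c).inner ℝ h).congr_deriv ?_
  rw [inner_diagMul_comm c g']; ring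

/-! ### The Chaplygin multiplier and the Hamiltonian -/

/-- The multiplier `ν(γ) = (Aγ, γ)^{-3/2}`. -/
def chaplyginMultiplier (a : Fin n → ℝ) (γ : E n) : ℝ := (√⟪diagMul a γ, γ⟫_ℝ ^ 3)⁻¹

/-- `H(γ, p) = ½ (Aγ, γ) ((Aγ, γ) (A⁻¹p, p) - (γ, p)²)`. On `T*S^{n-1}` the last term drops out; it
makes the second factor a quadratic form in the angular momenta, see
`hamiltonian_eq_quadIntegral`. -/
def hamiltonian (a : Fin n → ℝ) (z : E n × E n) : ℝ :=
  1 / 2 * ⟪diagMul a z.1, z.1⟫_ℝ *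
    (⟪diagMul a z.1, z.1⟫_ℝ * ⟪diagMul (fun i => (a i)⁻¹) z.2, z.2⟫_ℝ - ⟪z.1, z.2⟫_ℝ ^ 2)

theorem contDiff_hamiltonian (a : Fin n → ℝ) {k : WithTop ℕ∞} : ContDiff ℝ k (hamiltonian a) := by
  have h1 : ContDiff ℝ k fun z : E n × E n => ⟪diagMul a z.1, z.1⟫_ℝ :=
    ((contDiff_diagMul a).comp contDiff_fst).inner ℝ contDiff_fst
  have h2 : ContDiff ℝ k fun z : E n × E n => ⟪diagMul (fun i => (a i)⁻¹) z.2, z.2⟫_ℝ :=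
    ((contDiff_diagMul _).comp contDiff_snd).inner ℝ contDiff_snd
  have h3 : ContDiff ℝ k fun z : E n × E n => ⟪z.1, z.2⟫_ℝ := contDiff_fst.inner ℝ contDiff_snd
  exact (contDiff_const.mul h1).mul ((h1.mul h2).sub (h3.pow 2))

theorem fderiv_eq_of_hasDerivAt_line {F : E n × E n → ℝ} {z η : E n × E n} {d : ℝ}
    (hF : DifferentiableAt ℝ F z)
    (h : HasDerivAt (fun s : ℝ => F (z.1 + s • η.1, z.2 + s • η.2)) d 0) :
    fderiv ℝ F z η = d := by
  have hl : HasDerivAt (fun s : ℝ => z + s • η) η 0 := by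
    simpa using ((hasDerivAt_id (0 : ℝ)).smul_const η).const_add z
  have h1 : HasDerivAt (fun s : ℝ => F (z + s • η)) (fderiv ℝ F z η) 0 := by
    have hz : HasFDerivAt F (fderiv ℝ F z) (z + (0 : ℝ) • η) := by simpa using hF.hasFDerivAt
    exact hz.comp_hasDerivAt 0 hl
  exact h1.unique h

theorem hasDerivAt_line (X Y : E n) : HasDerivAt (fun s : ℝ => X + s • Y) Y 0 := by
  simpa using ((hasDerivAt_id (0 : ℝ)).smul_const Y).const_add X

theorem fderiv_hamiltonian (a : Fin n → ℝ) {z : E n × E n} (hz : ⟪z.1, z.2⟫_ℝ = 0)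
    (η : E n × E n) :
    fderiv ℝ (hamiltonian a) z η =
      2 * ⟪diagMul a z.1, z.1⟫_ℝ * ⟪diagMul (fun i => (a i)⁻¹) z.2, z.2⟫_ℝ * ⟪diagMul a z.1, η.1⟫_ℝ
      + ⟪diagMul a z.1, z.1⟫_ℝ ^ 2 * ⟪diagMul (fun i => (a i)⁻¹) z.2, η.2⟫_ℝ := by
  refine fderiv_eq_of_hasDerivAt_line
    ((contDiff_hamiltonian (k := 1) a).differentiable (by norm_num) z) ?_
  have h1 := hasDerivAt_quadForm a (hasDerivAt_line z.1 η.1)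
  have h2 := hasDerivAt_quadForm (fun i => (a i)⁻¹) (hasDerivAt_line z.2 η.2)
  have h3 := (hasDerivAt_line z.1 η.1).inner ℝ (hasDerivAt_line z.2 η.2)
  refine ((h1.const_mul (1 / 2)).mul ((h1.mul h2).sub (h3.pow 2))).congr_deriv ?_
  simp [hz]
  ring

theorem reducedFlat_neg_one
    (hI : ∀ X Y : E n, I₀ (wedge X Y) = wedge (diagMul a X) (diagMul a Y)) (γ X : E n) :
    reducedFlat (-1) I₀ γ X =
      ⟪diagMul a γ, γ⟫_ℝ • diagMul a X - ⟪diagMul a γ, X⟫_ℝ • diagMul a γ := by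
  rw [reducedFlat, act_inertia hI, inner_diagMul_comm a X]
  norm_num

theorem diagMul_inv_diagMul (ha : ∀ i, 0 < a i) (X : E n) :
    diagMul (fun i => (a i)⁻¹) (diagMul a X) = X := by
  ext i
  simp [inv_mul_cancel_left₀ (ha i).ne']

theorem chaplyginMultiplier_pos (ha : ∀ i, 0 < a i) {γ : E n} (hγ : γ ≠ 0) :
    0 < chaplyginMultiplier a γ := by
  have := Real.sqrt_pos.2 (inner_diagMul_self_pos ha hγ)
  rw [chaplyginMultiplier]; positivity

theorem chaplyginMultiplier_sq (ha : ∀ i, 0 < a i) {γ : E n} (hγ : γ ≠ 0) :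
    chaplyginMultiplier a γ ^ 2 * ⟪diagMul a γ, γ⟫_ℝ ^ 3 = 1 := by
  have h := inner_diagMul_self_pos ha hγ
  have hs := Real.sqrt_pos.2 h
  have : ⟪diagMul a γ, γ⟫_ℝ = √⟪diagMul a γ, γ⟫_ℝ ^ 2 := (Real.sq_sqrt h.le).symm
  rw [chaplyginMultiplier]
  set r := √⟪diagMul a γ, γ⟫_ℝ
  rw [this]; field_simp

theorem hasDerivAt_chaplyginMultiplier (ha : ∀ i, 0 < a i) {γ : ℝ → E n} {γ' : E n} {t : ℝ}
    (h : HasDerivAt γ γ' t) (hγ : γ t ≠ 0) :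
    HasDerivAt (fun τ => chaplyginMultiplier a (γ τ))
      (-3 * ⟪diagMul a (γ t), γ'⟫_ℝ * chaplyginMultiplier a (γ t) / ⟪diagMul a (γ t), γ t⟫_ℝ) t := by
  have hN := inner_diagMul_self_pos ha hγ
  have hs := Real.sqrt_pos.2 hN
  refine ((((hasDerivAt_quadForm a h).sqrt hN.ne').fun_pow 3).fun_inv (pow_pos hs 3).ne').congr_deriv ?_
  rw [chaplyginMultiplier]
  have : ⟪diagMul a (γ t), γ t⟫_ℝ = √⟪diagMul a (γ t), γ t⟫_ℝ ^ 2 := (Real.sq_sqrt hN.le).symm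
  set r := √⟪diagMul a (γ t), γ t⟫_ℝ
  rw [this]; field_simp; norm_num; ring

/-- The multiplier `(Aγ, γ)^{-3/2}` turns the reduced system with `ε = -1` into the Hamiltonian
system of `hamiltonian a`. -/
theorem isHamiltonization_hamiltonian (ha : ∀ i, 0 < a i)
    (hI : ∀ X Y : E n, I₀ (wedge X Y) = wedge (diagMul a X) (diagMul a Y)) :
    IsHamiltonization (-1) I₀ (chaplyginMultiplier a) (hamiltonian a) where
  smooth_multiplier := by
    have h1 : ContDiffOn ℝ ∞ (fun γ : E n => ⟪diagMul a γ, γ⟫_ℝ) {0}ᶜ :=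
      ((contDiff_diagMul a).inner ℝ contDiff_id).contDiffOn
    refine ContDiffOn.inv ((h1.sqrt fun γ hγ => ?_).pow 3) fun γ hγ => ?_
    · exact (inner_diagMul_self_pos ha hγ).ne'
    · exact pow_ne_zero 3 (Real.sqrt_pos.2 (inner_diagMul_self_pos ha hγ)).ne'
  multiplier_ne_zero γ hγ := (chaplyginMultiplier_pos ha (ne_zero_of_norm_eq_one hγ)).ne'
  smooth_hamiltonian := contDiff_hamiltonian a
  legendre γ X hγ hX := by
    have hν := chaplyginMultiplier_sq ha (ne_zero_of_norm_eq_one hγ)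
    rw [reducedMetric, reducedFlat_neg_one hI]
    simp only [hamiltonian, diagMul_smul, diagMul_sub, diagMul_inv_diagMul ha, inner_smul_left,
      inner_smul_right, inner_sub_left, inner_sub_right, conj_trivial,
      real_inner_comm (diagMul a γ) γ, real_inner_comm (diagMul a X) γ, inner_diagMul_comm a X γ,
      real_inner_comm (diagMul a X) X, real_inner_comm (diagMul a γ) X]
    linear_combination (1 / 2 * (⟪diagMul a γ, γ⟫_ℝ * ⟪diagMul a X, X⟫_ℝ - ⟪diagMul a γ, X⟫_ℝ ^ 2))
      * hν
  motion_iff γ I hc := by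
    have hred : IsReducedMotion (-1) I₀ γ I ↔ ∀ t ∈ I, ∀ ξ : E n, ⟪γ t, ξ⟫_ℝ = 0 →
        ⟪deriv (fun τ => reducedFlat (-1) I₀ (γ τ) (deriv γ τ)) t, ξ⟫_ℝ
          + 2 * ⟪diagMul a (deriv γ t), deriv γ t⟫_ℝ * ⟪diagMul a (γ t), ξ⟫_ℝ
          - 2 * ⟪diagMul a (γ t), deriv γ t⟫_ℝ * ⟪diagMul a (deriv γ t), ξ⟫_ℝ = 0 := by
      have hd (t : ℝ) : deriv (fun τ => reducedFlat (-1) I₀ (γ τ) (deriv γ τ)) t =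
          -deriv (fun τ => act (I₀ (wedge (γ τ) (deriv γ τ))) (γ τ)) t := by
        rw [← deriv.fun_neg]
        congr 1
        funext τ
        simp [reducedFlat]
      have key (t : ℝ) (ξ : E n) :
          ⟪(-1 : ℝ) • deriv (fun τ => act (I₀ (wedge (γ τ) (deriv γ τ))) (γ τ)) t
            + (1 - (-1 : ℝ)) • act (I₀ (wedge (γ t) (deriv γ t))) (deriv γ t), ξ⟫_ℝ =
          ⟪deriv (fun τ => reducedFlat (-1) I₀ (γ τ) (deriv γ τ)) t, ξ⟫_ℝ
          + 2 * ⟪diagMul a (deriv γ t), deriv γ t⟫_ℝ * ⟪diagMul a (γ t), ξ⟫_ℝ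
          - 2 * ⟪diagMul a (γ t), deriv γ t⟫_ℝ * ⟪diagMul a (deriv γ t), ξ⟫_ℝ := by
        rw [hd, act_inertia hI]
        simp only [inner_add_left, inner_smul_left, inner_sub_left, inner_neg_left, conj_trivial]
        ring
      refine ⟨fun h t ht ξ hξ => ?_, fun h => ⟨hc, fun t ht ξ hξ => ?_⟩⟩
      · rw [← key]; exact h.eq_motion t ht ξ hξ
      · rw [key]; exact h t ht ξ hξ
    rw [hred]
    refine forall₂_congr fun t ht => ?_
    have hγ0 := ne_zero_of_norm_eq_one (hc.norm_eq_one t ht)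
    have h1 := hc.hasDerivAt ht
    have h2 := hc.hasDerivAt_deriv ht
    have hN := inner_diagMul_self_pos ha hγ0
    have hν := chaplyginMultiplier_sq ha hγ0
    have hνpos := chaplyginMultiplier_pos ha hγ0
    have hw : DifferentiableAt ℝ (fun τ => reducedFlat (-1) I₀ (γ τ) (deriv γ τ)) t := by
      simp only [reducedFlat_neg_one hI]
      exact (((hasDerivAt_quadForm a h1).smul (h2.diagMul a)).sub
        (((h1.diagMul a).inner ℝ h2).smul (h1.diagMul a))).differentiableAt
    have hp := (hasDerivAt_chaplyginMultiplier ha h1 hγ0).fun_smul hw.hasDerivAt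
    have hpair := h1.prodMk hp
    have hγγ := hc.inner_self ht
    have hort := hc.inner_deriv ht
    have hflat (τ : ℝ) (hτ : τ ∈ I) :
        ⟪γ τ, chaplyginMultiplier a (γ τ) • reducedFlat (-1) I₀ (γ τ) (deriv γ τ)⟫_ℝ = 0 := by
      rw [reducedFlat_neg_one hI, inner_smul_right, inner_sub_right, inner_smul_right,
        inner_smul_right, real_inner_comm (diagMul a (deriv γ τ)), inner_diagMul_comm a (deriv γ τ),
        real_inner_comm (diagMul a (γ τ))]
      ring
    have htan := hasDerivAt_inner_eq_zero hc.isOpen ht h1 hp hflat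
    rw [hpair.deriv]
    set ν := chaplyginMultiplier a (γ t) with hνdef
    have hνinv : ν⁻¹ = ν * ⟪diagMul a (γ t), γ t⟫_ℝ ^ 3 := by
      field_simp; linear_combination -hν
    set w' := deriv (fun τ => reducedFlat (-1) I₀ (γ τ) (deriv γ τ)) t with hw'
    -- The defect of Hamilton's equations is minus the defect of the equations of motion.
    have key (η : E n × E n) (hη : η ∈ tangent (γ t, ν • reducedFlat (-1) I₀ (γ t) (deriv γ t))) :
        symplecticForm (ν⁻¹ • (deriv γ t,
            ν • w' + (-3 * ⟪diagMul a (γ t), deriv γ t⟫_ℝ * ν / ⟪diagMul a (γ t), γ t⟫_ℝ) •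
              reducedFlat (-1) I₀ (γ t) (deriv γ t))) η
          - fderiv ℝ (hamiltonian a) (γ t, ν • reducedFlat (-1) I₀ (γ t) (deriv γ t)) η =
        -(⟪w', η.1⟫_ℝ
          + 2 * ⟪diagMul a (deriv γ t), deriv γ t⟫_ℝ * ⟪diagMul a (γ t), η.1⟫_ℝ
          - 2 * ⟪diagMul a (γ t), deriv γ t⟫_ℝ * ⟪diagMul a (deriv γ t), η.1⟫_ℝ) := by
      have hη2 : ⟪γ t, η.2⟫_ℝ + ⟪ν • reducedFlat (-1) I₀ (γ t) (deriv γ t), η.1⟫_ℝ = 0 := hη.2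
      rw [fderiv_hamiltonian a (hflat t ht)]
      rw [reducedFlat_neg_one hI] at hη2 ⊢
      simp only [symplecticForm, Prod.smul_fst, Prod.smul_snd, diagMul_smul, diagMul_sub,
        diagMul_inv_diagMul ha, inner_add_left, inner_smul_left,
        inner_smul_right, inner_sub_left, inner_sub_right, conj_trivial,
        real_inner_comm (diagMul a (γ t)) (γ t), real_inner_comm (diagMul a (deriv γ t)) (γ t),
        inner_diagMul_comm a (deriv γ t) (γ t), real_inner_comm (diagMul a (γ t)) (deriv γ t),
        real_inner_comm (diagMul a (deriv γ t)) (deriv γ t), hνinv] at hη2 ⊢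
      generalize ⟪diagMul a (γ t), γ t⟫_ℝ = N at *
      generalize ⟪diagMul a (γ t), deriv γ t⟫_ℝ = b at *
      generalize ⟪diagMul a (deriv γ t), deriv γ t⟫_ℝ = c at *
      generalize ⟪diagMul a (γ t), η.1⟫_ℝ = g at *
      generalize ⟪diagMul a (deriv γ t), η.1⟫_ℝ = k at *
      generalize ⟪w', η.1⟫_ℝ = D at *
      have hq : N⁻¹ * N = 1 := inv_mul_cancel₀ hN.ne'
      rw [div_eq_mul_inv]
      linear_combination -(D + 2 * c * g - 2 * b * k) * hν + N ^ 2 * ν * b * hη2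
        + 3 * b * ν ^ 2 * N ^ 2 * (N * k - b * g) * hq
    constructor
    · intro h
      refine ⟨⟨?_, ?_⟩, fun η hη => ?_⟩
      · simp [inner_smul_right, hort]
      · simp only [Prod.smul_fst, Prod.smul_snd]
        rw [inner_smul_right, inner_smul_right, ← mul_add,
          real_inner_comm (deriv γ t) (ν • _), htan,
          mul_zero]
      · rw [← sub_eq_zero, key η hη, h η.1 hη.1, neg_zero]
    · rintro ⟨-, h⟩ ξ hξ
      -- Every tangent vector of the sphere lifts to a tangent vector of its cotangent bundle.
      have hη : (ξ, -⟪ν • reducedFlat (-1) I₀ (γ t) (deriv γ t), ξ⟫_ℝ • γ t) ∈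
          tangent (γ t, ν • reducedFlat (-1) I₀ (γ t) (deriv γ t)) := by
        refine ⟨hξ, ?_⟩
        simp only [inner_smul_right, hγγ]; ring
      have := key _ hη
      rw [h _ hη, sub_self] at this
      linarith

/-! ### Quadratic integrals in the angular momenta and their brackets -/

theorem sum_sum_eq_zero_of_antisymm {F : Fin n → Fin n → ℝ} (h : ∀ i j, F i j + F j i = 0) :
    ∑ i, ∑ j, F i j = 0 := by
  have h1 : ∑ i, ∑ j, F i j = ∑ i, ∑ j, F j i := Finset.sum_comm
  have h2 : ∑ i, ∑ j, F i j + ∑ i, ∑ j, F j i = 0 := by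
    simp only [← Finset.sum_add_distrib, h, Finset.sum_const_zero]
  linarith

theorem sum_sum_sum_eq_zero_of_symmetrization {F : Fin n → Fin n → Fin n → ℝ}
    (h : ∀ i j k, F i j k + F i k j + F j i k + F j k i + F k i j + F k j i = 0) :
    ∑ i, ∑ j, ∑ k, F i j k = 0 := by
  have s12 (G : Fin n → Fin n → Fin n → ℝ) :
      ∑ i, ∑ j, ∑ k, G i j k = ∑ i, ∑ j, ∑ k, G j i k := Finset.sum_comm
  have s23 (G : Fin n → Fin n → Fin n → ℝ) :
      ∑ i, ∑ j, ∑ k, G i j k = ∑ i, ∑ j, ∑ k, G i k j :=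
    Finset.sum_congr rfl fun i _ => Finset.sum_comm
  have h1 := s23 F
  have h2 := s12 F
  have h3 := s23 fun i j k => F j i k
  have h4 := s12 fun i j k => F i k j
  have h5 := s12 fun i j k => F k i j
  have h6 : ∑ i, ∑ j, ∑ k, (F i j k + F i k j + F j i k + F j k i + F k i j + F k j i) = 0 := by
    simp only [h, Finset.sum_const_zero]
  simp only [Finset.sum_add_distrib] at h6
  linarith

/-- The angular momenta `u_i v_j - u_j v_i`. -/
def angMom (u v : Fin n → ℝ) (i j : Fin n) : ℝ := u i * v j - u j * v i

/-- The coordinates `u = A^{1/2} γ` on `T*ℝⁿ`. -/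
def scaledPos (a : Fin n → ℝ) (x : E n) (i : Fin n) : ℝ := √(a i) * x i

/-- The momenta `v = A^{-1/2} p` conjugate to `u = A^{1/2} γ`. -/
def scaledMom (a : Fin n → ℝ) (p : E n) (i : Fin n) : ℝ := p i / √(a i)

/-- The function `½ ∑ Wᵢⱼ Lᵢⱼ² - (∑ bᵢ uᵢ²) (½ ∑ Lᵢⱼ²)`, where `L` are the angular momenta in the
canonical coordinates `u = A^{1/2} γ`, `v = A^{-1/2} p`. -/
def quadIntegral (a : Fin n → ℝ) (W : Fin n → Fin n → ℝ) (b : Fin n → ℝ) (z : E n × E n) : ℝ :=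
  1 / 2 * ∑ i, ∑ j, W i j * angMom (scaledPos a z.1) (scaledMom a z.2) i j ^ 2
    - (∑ i, b i * scaledPos a z.1 i ^ 2) *
      (1 / 2 * ∑ i, ∑ j, angMom (scaledPos a z.1) (scaledMom a z.2) i j ^ 2)

/-- The position gradient of `½ ∑ Wᵢⱼ Lᵢⱼ² - l ∑ bᵢ uᵢ²` for constant `W`, `b`, `l`. -/
def posGrad (W : Fin n → Fin n → ℝ) (b : Fin n → ℝ) (l : ℝ) (u v : Fin n → ℝ) (i : Fin n) : ℝ :=
  2 * ∑ j, W i j * angMom u v i j * v j - 2 * l * b i * u i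

/-- The momentum gradient of `½ ∑ Wᵢⱼ Lᵢⱼ²` for constant `W`. -/
def momGrad (W : Fin n → Fin n → ℝ) (u v : Fin n → ℝ) (i : Fin n) : ℝ :=
  -2 * ∑ j, W i j * angMom u v i j * u j

theorem contDiff_quadIntegral (a : Fin n → ℝ) (W : Fin n → Fin n → ℝ) (b : Fin n → ℝ)
    {k : WithTop ℕ∞} : ContDiff ℝ k (quadIntegral a W b) := by
  unfold quadIntegral angMom scaledPos scaledMom
  simp only [div_eq_mul_inv]
  fun_prop

theorem scaledPos_line (a : Fin n → ℝ) (x y : E n) (s : ℝ) (i : Fin n) :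
    scaledPos a (x + s • y) i = scaledPos a x i + s * scaledPos a y i := by
  simp [scaledPos]; ring

theorem scaledMom_line (a : Fin n → ℝ) (x y : E n) (s : ℝ) (i : Fin n) :
    scaledMom a (x + s • y) i = scaledMom a x i + s * scaledMom a y i := by
  simp [scaledMom]; ring

theorem hasDerivAt_affine (x y : ℝ) : HasDerivAt (fun s : ℝ => x + s * y) y 0 := by
  simpa using ((hasDerivAt_id (0 : ℝ)).mul_const y).const_add x

theorem hasDerivAt_weighted_sum_sq {u v ξ θ : Fin n → ℝ} {W : Fin n → Fin n → ℝ}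
    (hW : ∀ i j, W i j = W j i) :
    HasDerivAt (fun s : ℝ => 1 / 2 * ∑ i, ∑ j, W i j *
        angMom (fun i => u i + s * ξ i) (fun i => v i + s * θ i) i j ^ 2)
      (∑ i, (ξ i * (2 * ∑ j, W i j * angMom u v i j * v j) + θ i * momGrad W u v i)) 0 := by
  have hL (i j : Fin n) : HasDerivAt
      (fun s : ℝ => angMom (fun i => u i + s * ξ i) (fun i => v i + s * θ i) i j)
      (ξ i * v j + u i * θ j - (ξ j * v i + u j * θ i)) 0 := by
    refine (((hasDerivAt_affine (u i) (ξ i)).fun_mul (hasDerivAt_affine (v j) (θ j))).fun_sub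
      ((hasDerivAt_affine (u j) (ξ j)).fun_mul (hasDerivAt_affine (v i) (θ i)))).congr_deriv ?_
    simp
  refine ((HasDerivAt.fun_sum fun i _ => HasDerivAt.fun_sum fun j _ =>
    ((hL i j).fun_pow 2).const_mul (W i j)).const_mul (1 / 2)).congr_deriv ?_
  simp only [momGrad, Finset.mul_sum, ← Finset.sum_add_distrib]
  rw [← sub_eq_zero]
  simp only [← Finset.sum_sub_distrib]
  refine sum_sum_eq_zero_of_antisymm fun i j => ?_
  simp only [angMom, hW j i]
  norm_num
  ring

theorem fderiv_quadIntegral (a : Fin n → ℝ) {W : Fin n → Fin n → ℝ} (hW : ∀ i j, W i j = W j i)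
    (b : Fin n → ℝ) (z η : E n × E n) :
    fderiv ℝ (quadIntegral a W b) z η =
      ∑ i, (scaledPos a η.1 i *
          posGrad (fun i j => W i j - ∑ k, b k * scaledPos a z.1 k ^ 2) b
            (1 / 2 * ∑ i, ∑ j, angMom (scaledPos a z.1) (scaledMom a z.2) i j ^ 2)
            (scaledPos a z.1) (scaledMom a z.2) i
        + scaledMom a η.2 i *
          momGrad (fun i j => W i j - ∑ k, b k * scaledPos a z.1 k ^ 2)
            (scaledPos a z.1) (scaledMom a z.2) i) := by
  refine fderiv_eq_of_hasDerivAt_line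
    ((contDiff_quadIntegral (k := 1) a W b).differentiable (by norm_num) z) ?_
  have h1 := hasDerivAt_weighted_sum_sq (u := scaledPos a z.1) (v := scaledMom a z.2)
    (ξ := scaledPos a η.1) (θ := scaledMom a η.2) hW
  have h2 := hasDerivAt_weighted_sum_sq (u := scaledPos a z.1) (v := scaledMom a z.2)
    (ξ := scaledPos a η.1) (θ := scaledMom a η.2) (W := fun _ _ => 1) fun _ _ => rfl
  have h3 : HasDerivAt (fun s : ℝ => ∑ i, b i * (scaledPos a z.1 i + s * scaledPos a η.1 i) ^ 2)
      (∑ i, b i * (2 * scaledPos a z.1 i * scaledPos a η.1 i)) 0 := by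
    refine (HasDerivAt.fun_sum fun i _ => ((hasDerivAt_affine (scaledPos a z.1 i)
      (scaledPos a η.1 i)).fun_pow 2).const_mul (b i)).congr_deriv ?_
    simp
  have h4 := h1.fun_sub (h3.fun_mul h2)
  simp only [one_mul] at h4
  unfold quadIntegral
  simp only [scaledPos_line, funext (scaledPos_line a z.1 η.1 _),
    funext (scaledMom_line a z.2 η.2 _)]
  refine h4.congr_deriv ?_
  simp only [zero_mul, add_zero, posGrad, momGrad]
  generalize scaledPos a z.1 = u
  generalize scaledMom a z.2 = v
  generalize 1 / 2 * ∑ i, ∑ j, angMom u v i j ^ 2 = l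
  generalize ∑ k, b k * u k ^ 2 = q
  rw [Finset.sum_mul, Finset.mul_sum, ← Finset.sum_add_distrib, ← Finset.sum_sub_distrib]
  refine Finset.sum_congr rfl fun i _ => ?_
  simp only [sub_mul, Finset.sum_sub_distrib, one_mul, mul_assoc, ← Finset.mul_sum]
  ring

/-- The relation `(cᵢ - cⱼ) Wᵢⱼ = bᵢ - bⱼ` between the weights of a `quadIntegral`. -/
structure IsCompatible (c : Fin n → ℝ) (W : Fin n → Fin n → ℝ) (b : Fin n → ℝ) : Prop where
  symm : ∀ i j, W i j = W j i
  rel : ∀ i j, (c i - c j) * W i j = b i - b j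

/-- Manakov's condition for `∑ Wᵢⱼ Lᵢⱼ²` and `∑ Zᵢⱼ Lᵢⱼ²` to commute: for all `i`, `j`, `k` the
vectors `(1, 1, 1)`, `(Wᵢⱼ, Wⱼₖ, Wₖᵢ)` and `(Zᵢⱼ, Zⱼₖ, Zₖᵢ)` are linearly dependent. -/
def ManakovCondition (W Z : Fin n → Fin n → ℝ) : Prop :=
  ∀ i j k, W i j * Z j k + W j k * Z k i + W k i * Z i j =
    Z i j * W j k + Z j k * W k i + Z k i * W i j

/-- The bracket of two quadratic integrals, computed from their gradients. The part cubic in `L` has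
coefficients antisymmetric in three indices and vanishes by Manakov's condition; in the part
containing `l` the two contributions cancel, as `(bᵢ - bⱼ) Zᵢⱼ = (cᵢ - cⱼ) Wᵢⱼ Zᵢⱼ = (dᵢ - dⱼ) Wᵢⱼ`. -/
theorem bracket_eq_zero {c : Fin n → ℝ} {W Z : Fin n → Fin n → ℝ} {b d : Fin n → ℝ}
    (hW : IsCompatible c W b) (hZ : IsCompatible c Z d) (hWZ : ManakovCondition W Z)
    (l : ℝ) (u v : Fin n → ℝ) :
    ∑ i, (posGrad W b l u v i * momGrad Z u v i - momGrad W u v i * posGrad Z d l u v i) = 0 := by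
  have h3 : ∑ i, ∑ j, ∑ k, W i j * Z i k * (angMom u v i j * angMom u v i k * angMom u v k j)
      = 0 := by
    refine sum_sum_sum_eq_zero_of_symmetrization fun i j k => ?_
    rw [hW.symm j i, hW.symm i k, hW.symm k j, hZ.symm j i, hZ.symm i k, hZ.symm k j]
    simp only [angMom]
    linear_combination -((u i * v j - u j * v i) * (u j * v k - u k * v j)
      * (u k * v i - u i * v k)) * (hWZ i j k)
  have h2 : ∑ i, ∑ j, (b i * u i * (Z i j * angMom u v i j * u j)
      - d i * u i * (W i j * angMom u v i j * u j)) = 0 := by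
    refine sum_sum_eq_zero_of_antisymm fun i j => ?_
    rw [hW.symm j i, hZ.symm j i]
    simp only [angMom]
    linear_combination (-(u i * v j - u j * v i) * u i * u j) *
      (Z i j * hW.rel i j - W i j * hZ.rel i j)
  have key : ∑ i, (posGrad W b l u v i * momGrad Z u v i - momGrad W u v i * posGrad Z d l u v i) =
      4 * (∑ i, ∑ j, ∑ k, W i j * Z i k * (angMom u v i j * angMom u v i k * angMom u v k j))
      * (-1) + 4 * l * ∑ i, ∑ j, (b i * u i * (Z i j * angMom u v i j * u j)
      - d i * u i * (W i j * angMom u v i j * u j)) := by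
    rw [Finset.mul_sum, Finset.sum_mul, Finset.mul_sum, ← Finset.sum_add_distrib]
    refine Finset.sum_congr rfl fun i _ => ?_
    have e : ∑ j, ∑ k, W i j * Z i k * (angMom u v i j * angMom u v i k * angMom u v k j) =
        (∑ j, W i j * angMom u v i j * v j) * (∑ k, Z i k * angMom u v i k * u k)
        - (∑ j, W i j * angMom u v i j * u j) * (∑ k, Z i k * angMom u v i k * v k) := by
      rw [Finset.sum_mul_sum, Finset.sum_mul_sum, ← Finset.sum_sub_distrib]
      refine Finset.sum_congr rfl fun j _ => ?_
      rw [← Finset.sum_sub_distrib]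
      refine Finset.sum_congr rfl fun k _ => ?_
      rw [angMom.eq_def u v k j]; ring
    rw [e, Finset.sum_sub_distrib, ← Finset.mul_sum, ← Finset.mul_sum]
    simp only [posGrad, momGrad]
    ring
  rw [key, h3, h2]; ring

/-- Two functions are in involution on `T*S^{n-1}` if at each point their differentials along the
submanifold are represented by Hamiltonian vectors of the ambient space which preserve the
constraint `(x, p) = 0` and are symplectically orthogonal. Such vectors are made tangent by adding
multiples of `(x, -p)`, the Hamiltonian vector of the constraint. -/
theorem inInvolution_of_ambient {f g : E n × E n → ℝ} (X Y : E n × E n → E n × E n)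
    (hX : ∀ z ∈ cotangentSphere n, ∀ η ∈ tangent z, fderiv ℝ f z η = symplecticForm (X z) η)
    (hY : ∀ z ∈ cotangentSphere n, ∀ η ∈ tangent z, fderiv ℝ g z η = symplecticForm (Y z) η)
    (hXt : ∀ z ∈ cotangentSphere n, ⟪z.1, (X z).2⟫_ℝ + ⟪z.2, (X z).1⟫_ℝ = 0)
    (hYt : ∀ z ∈ cotangentSphere n, ⟪z.1, (Y z).2⟫_ℝ + ⟪z.2, (Y z).1⟫_ℝ = 0)
    (hXY : ∀ z ∈ cotangentSphere n, symplecticForm (X z) (Y z) = 0) : InInvolution f g := by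
  intro z hz ζ ζ' ⟨hζ, hf⟩ ⟨hζ', hg⟩
  have hzz : ⟪z.1, z.1⟫_ℝ = 1 := by rw [real_inner_self_eq_norm_sq, hz.1, one_pow]
  have hzp : ⟪z.1, z.2⟫_ℝ = 0 := hz.2
  have hη : X z + (-⟪z.1, (X z).1⟫_ℝ) • (z.1, -z.2) ∈ tangent z := by
    refine ⟨?_, ?_⟩
    · simp only [Prod.fst_add, Prod.smul_fst, inner_add_right, inner_smul_right, hzz]; ring
    · simp only [Prod.fst_add, Prod.smul_fst, Prod.snd_add, Prod.smul_snd, inner_add_right,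
        inner_smul_right, inner_neg_right, hzp, real_inner_comm z.1 z.2]
      linarith [hXt z hz]
  rw [hf ζ' hζ', hX z hz ζ' hζ']
  have h1 := hg _ hη
  rw [hY z hz _ hη] at h1
  have h2 := hYt z hz
  have h3 := hXY z hz
  have h4 : ⟪z.1, ζ'.2⟫_ℝ + ⟪z.2, ζ'.1⟫_ℝ = 0 := hζ'.2
  simp only [symplecticForm, Prod.fst_add, Prod.smul_fst, Prod.snd_add, Prod.smul_snd,
    inner_add_right, inner_smul_right, inner_neg_right, real_inner_comm ζ'.1,
    real_inner_comm ζ'.2] at *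
  simp only [real_inner_comm (Y z).1, real_inner_comm (Y z).2] at *
  linear_combination -h1 + h3 + ⟪z.1, (X z).1⟫_ℝ * (h4 - h2)

theorem scaledPos_mul_scaledMom (ha : ∀ i, 0 < a i) (x p : E n) (i : Fin n) :
    scaledPos a x i * scaledMom a p i = x i * p i := by
  have := (Real.sqrt_pos.2 (ha i)).ne'
  rw [scaledPos, scaledMom]; field_simp

theorem sum_inv_mul_scaledPos (ha : ∀ i, 0 < a i) (x y : E n) :
    ∑ i, (a i)⁻¹ * (scaledPos a x i * scaledPos a y i) = ⟪x, y⟫_ℝ := by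
  rw [inner_eq_sum]
  refine Finset.sum_congr rfl fun i _ => ?_
  have h := Real.mul_self_sqrt (ha i).le
  have := (ha i).ne'
  simp only [scaledPos]
  field_simp
  linear_combination (x i * y i) * h

/-- Functions `quadIntegral a W b` with compatible weights are in involution. At a point of
`T*S^{n-1}` the weights may be shifted by `(W, b) ↦ (W - q, b - q A⁻¹)`, `q = ∑ bᵢ uᵢ²`: this
changes the differential by a multiple of that of the constraint `∑ uᵢ² / aᵢ = 1`. -/
theorem inInvolution_quadIntegral (ha : ∀ i, 0 < a i) {W Z : Fin n → Fin n → ℝ} {b d : Fin n → ℝ}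
    (hW : IsCompatible (fun i => (a i)⁻¹) W b) (hZ : IsCompatible (fun i => (a i)⁻¹) Z d)
    (hWZ : ManakovCondition W Z) : InInvolution (quadIntegral a W b) (quadIntegral a Z d) := by
  set u : E n × E n → Fin n → ℝ := fun z => scaledPos a z.1 with hu
  set v : E n × E n → Fin n → ℝ := fun z => scaledMom a z.2 with hv
  set l : E n × E n → ℝ := fun z => 1 / 2 * ∑ i, ∑ j, angMom (u z) (v z) i j ^ 2 with hl
  set q : (Fin n → ℝ) → E n × E n → ℝ := fun b z => ∑ k, b k * u z k ^ 2 with hq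
  let Ws (W : Fin n → Fin n → ℝ) (b : Fin n → ℝ) (z : E n × E n) : Fin n → Fin n → ℝ :=
    fun i j => W i j - q b z
  let bs (b : Fin n → ℝ) (z : E n × E n) : Fin n → ℝ := fun i => b i - q b z * (a i)⁻¹
  let X (W : Fin n → Fin n → ℝ) (b : Fin n → ℝ) (z : E n × E n) : E n × E n :=
    (WithLp.toLp 2 fun i => momGrad (Ws W b z) (u z) (v z) i / √(a i),
      WithLp.toLp 2 fun i => -(√(a i) * posGrad (Ws W b z) (bs b z) (l z) (u z) (v z) i))
  have hs (i : Fin n) := (Real.sqrt_pos.2 (ha i)).ne'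
  have hcompat {W : Fin n → Fin n → ℝ} {b : Fin n → ℝ} (h : IsCompatible (fun i => (a i)⁻¹) W b)
      (z : E n × E n) : IsCompatible (fun i => (a i)⁻¹) (Ws W b z) (bs b z) := by
    refine ⟨fun i j => ?_, fun i j => ?_⟩
    · simp only [Ws, h.symm i j]
    · simp only [Ws, bs]; linear_combination h.rel i j
  have hform {W : Fin n → Fin n → ℝ} {b : Fin n → ℝ} (z η : E n × E n) :
      symplecticForm (X W b z) η =
        ∑ i, (scaledPos a η.1 i * posGrad (Ws W b z) (bs b z) (l z) (u z) (v z) i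
          + scaledMom a η.2 i * momGrad (Ws W b z) (u z) (v z) i) := by
    simp only [symplecticForm, inner_eq_sum, X, ← Finset.sum_sub_distrib]
    refine Finset.sum_congr rfl fun i _ => ?_
    rw [scaledPos, scaledMom]; ring
  have hrep {W : Fin n → Fin n → ℝ} {b : Fin n → ℝ} (h : IsCompatible (fun i => (a i)⁻¹) W b)
      (z : E n × E n) (η : E n × E n) (hη : η ∈ tangent z) :
      fderiv ℝ (quadIntegral a W b) z η = symplecticForm (X W b z) η := by
    have h0 : ⟪z.1, η.1⟫_ℝ = 0 := hη.1
    rw [← sum_inv_mul_scaledPos ha] at h0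
    rw [hform, fderiv_quadIntegral a h.symm, ← sub_eq_zero, ← Finset.sum_sub_distrib]
    have : ∀ i, (scaledPos a η.1 i * posGrad (Ws W b z) b (l z) (u z) (v z) i
          + scaledMom a η.2 i * momGrad (Ws W b z) (u z) (v z) i)
          - (scaledPos a η.1 i * posGrad (Ws W b z) (bs b z) (l z) (u z) (v z) i
          + scaledMom a η.2 i * momGrad (Ws W b z) (u z) (v z) i) =
        -2 * l z * q b z * ((a i)⁻¹ * (scaledPos a z.1 i * scaledPos a η.1 i)) := by
      intro i
      simp only [posGrad, bs, hu]; ring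
    exact (Finset.sum_congr rfl fun i _ => this i).trans (by rw [← Finset.mul_sum, h0, mul_zero])
  have htan {W : Fin n → Fin n → ℝ} {b : Fin n → ℝ} (h : IsCompatible (fun i => (a i)⁻¹) W b)
      (z : E n × E n) (hz : z ∈ cotangentSphere n) :
      ⟪z.1, (X W b z).2⟫_ℝ + ⟪z.2, (X W b z).1⟫_ℝ = 0 := by
    have hzz : ⟪z.1, z.1⟫_ℝ = 1 := by rw [real_inner_self_eq_norm_sq, hz.1, one_pow]
    rw [← sum_inv_mul_scaledPos ha] at hzz
    have hqs : ∑ i, bs b z i * u z i ^ 2 = 0 := by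
      have : ∑ i, bs b z i * u z i ^ 2 =
          q b z - q b z * ∑ i, (a i)⁻¹ * (scaledPos a z.1 i * scaledPos a z.1 i) := by
        simp only [hq, bs, Finset.mul_sum, ← Finset.sum_sub_distrib]
        refine Finset.sum_congr rfl fun i _ => ?_
        simp only [hu]; ring
      rw [this, hzz]; ring
    have hanti : ∑ i, ∑ j, Ws W b z i j * angMom (u z) (v z) i j *
        (v z j * u z i + u z j * v z i) = 0 := by
      refine sum_sum_eq_zero_of_antisymm fun i j => ?_
      rw [(hcompat h z).symm j i]
      simp only [angMom]; ring
    have : ⟪z.1, (X W b z).2⟫_ℝ + ⟪z.2, (X W b z).1⟫_ℝ =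
        -2 * ∑ i, ∑ j, Ws W b z i j * angMom (u z) (v z) i j * (v z j * u z i + u z j * v z i)
        + 2 * l z * ∑ i, bs b z i * u z i ^ 2 := by
      simp only [inner_eq_sum, X]
      rw [Finset.mul_sum, Finset.mul_sum, ← Finset.sum_add_distrib, ← Finset.sum_add_distrib]
      refine Finset.sum_congr rfl fun i _ => ?_
      simp only [mul_add, Finset.sum_add_distrib, ← mul_assoc, ← Finset.sum_mul, posGrad, momGrad]
      have e1 : z.1 i * √(a i) = u z i := by simp only [hu, scaledPos]; ring
      have e2 : z.2 i / √(a i) = v z i := rfl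
      rw [← e1, ← e2]
      ring
    rw [this, hqs, hanti]; ring
  refine inInvolution_of_ambient (X W b) (X Z d) (fun z _ η hη => hrep hW z η hη)
    (fun z _ η hη => hrep hZ z η hη) (htan hW) (htan hZ) fun z _ => ?_
  rw [hform]
  have hM : ManakovCondition (Ws W b z) (Ws Z d z) := fun i j k => by
    simp only [Ws]; linear_combination hWZ i j k
  rw [← neg_eq_zero, ← Finset.sum_neg_distrib,
    ← bracket_eq_zero (hcompat hZ z) (hcompat hW z) (fun i j k => (hM i j k).symm)
      (l z) (u z) (v z)]
  refine Finset.sum_congr rfl fun i _ => ?_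
  simp only [X, scaledPos, scaledMom]
  field_simp [hs i]
  ring

/-- The Hamiltonian belongs to the family of quadratic integrals, by Lagrange's identity
`½ ∑ Lᵢⱼ² = |u|² |v|² - (u, v)²`. -/
theorem hamiltonian_eq_quadIntegral (ha : ∀ i, 0 < a i) :
    hamiltonian a = quadIntegral a 0 fun _ => -(1 / 2) := by
  funext z
  have h1 : ⟪diagMul a z.1, z.1⟫_ℝ = ∑ i, scaledPos a z.1 i ^ 2 := by
    rw [inner_eq_sum]
    refine Finset.sum_congr rfl fun i _ => ?_
    rw [diagMul_apply, scaledPos, mul_pow, Real.sq_sqrt (ha i).le]; ring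
  have h2 : ⟪diagMul (fun i => (a i)⁻¹) z.2, z.2⟫_ℝ = ∑ i, scaledMom a z.2 i ^ 2 := by
    rw [inner_eq_sum]
    refine Finset.sum_congr rfl fun i _ => ?_
    rw [diagMul_apply, scaledMom, div_pow, Real.sq_sqrt (ha i).le]; ring
  have h3 : ⟪z.1, z.2⟫_ℝ = ∑ i, scaledPos a z.1 i * scaledMom a z.2 i := by
    rw [inner_eq_sum]
    exact Finset.sum_congr rfl fun i _ => (scaledPos_mul_scaledMom ha z.1 z.2 i).symm
  have h4 (u v : Fin n → ℝ) : ∑ i, ∑ j, angMom u v i j ^ 2 =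
      2 * ((∑ i, u i ^ 2) * (∑ i, v i ^ 2) - (∑ i, u i * v i) ^ 2) := by
    have e1 : (∑ i, u i * v i) ^ 2 = ∑ i, ∑ j, u i * v i * (u j * v j) := by
      rw [sq, Finset.sum_mul_sum]
    have e2 : ∑ i, ∑ j, u j ^ 2 * v i ^ 2 = ∑ i, ∑ j, u i ^ 2 * v j ^ 2 := Finset.sum_comm
    have e3 : ∑ i, ∑ j, angMom u v i j ^ 2 = ∑ i, ∑ j, u i ^ 2 * v j ^ 2
        + ∑ i, ∑ j, u j ^ 2 * v i ^ 2 - 2 * ∑ i, ∑ j, u i * v i * (u j * v j) := by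
      simp only [Finset.mul_sum, ← Finset.sum_add_distrib, ← Finset.sum_sub_distrib]
      refine Finset.sum_congr rfl fun i _ => Finset.sum_congr rfl fun j _ => ?_
      rw [angMom]; ring
    rw [e3, e2, ← Finset.sum_mul_sum, e1]; ring
  rw [hamiltonian, quadIntegral, h1, h2, h3, h4]
  simp only [Pi.zero_apply, zero_mul, Finset.sum_const_zero, ← Finset.mul_sum]
  ring

/-! ### The complete set of integrals -/

/-- `k` is the smallest index in its block, the set of indices `i` with `aᵢ = aₖ`. -/
def IsBlockFirst (a : Fin n → ℝ) (k : Fin n) : Prop := ∀ j < k, a j ≠ a k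

open Classical in
/-- The weights `b` of the `k`-th integral. If `k` is the first index of its block this is the
indicator of the block, otherwise zero. -/
def posWeight (a : Fin n → ℝ) (k i : Fin n) : ℝ :=
  if IsBlockFirst a k ∧ a i = a k then 1 else 0

open Classical in
/-- The weights `W` of the `k`-th integral. If `k` is the first index of its block, they are the
divided differences of `posWeight a k` in the variables `1 / aᵢ` (zero inside a block, as
`x / 0 = 0`). Otherwise the integral is the Casimir function `∑ Lᵢⱼ²` of the rotations of those
indices of the block which do not exceed `k`. -/
def momWeight (a : Fin n → ℝ) (k i j : Fin n) : ℝ :=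
  if IsBlockFirst a k then (posWeight a k i - posWeight a k j) / ((a i)⁻¹ - (a j)⁻¹)
  else if a i = a k ∧ a j = a k ∧ i ≤ k ∧ j ≤ k then 1 else 0

theorem posWeight_congr (k : Fin n) {i j : Fin n} (h : a i = a j) :
    posWeight a k i = posWeight a k j := by
  unfold posWeight; rw [h]

theorem posWeight_of_not_first {k : Fin n} (h : ¬IsBlockFirst a k) (i : Fin n) :
    posWeight a k i = 0 := by
  simp [posWeight, h]

theorem momWeight_of_first_of_eq {k : Fin n} (h : IsBlockFirst a k) {i j : Fin n}
    (hij : a i = a j) : momWeight a k i j = 0 := by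
  simp [momWeight, h, hij]

theorem isCompatible_weights (k : Fin n) :
    IsCompatible (fun i => (a i)⁻¹) (momWeight a k) (posWeight a k) := by
  refine ⟨fun i j => ?_, fun i j => ?_⟩
  · unfold momWeight
    split_ifs with h1 h2 h3 h3
    · rw [← neg_sub, ← neg_sub (a j)⁻¹, neg_div_neg_eq]
    · rfl
    · exact absurd ⟨h2.2.1, h2.1, h2.2.2.2, h2.2.2.1⟩ h3
    · exact absurd ⟨h3.2.1, h3.1, h3.2.2.2, h3.2.2.1⟩ h2
    · rfl
  · by_cases hij : a i = a j
    · simp [hij, posWeight_congr k hij]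
    · by_cases hk : IsBlockFirst a k
      · have : (a i)⁻¹ - (a j)⁻¹ ≠ 0 := sub_ne_zero.2 fun h => hij (inv_injective h)
        simp only [momWeight, hk, if_true]
        rw [mul_div_cancel₀ _ this]
      · simp only [momWeight, hk, if_false, posWeight_of_not_first hk]
        rw [if_neg fun h => hij (h.1.trans h.2.1.symm)]
        ring

/-- Manakov's condition follows from the compatibility of both pairs of weights with the same
`c`, except at triples of indices of the same block: all the rows `(1, 1, 1)`,
`(Wᵢⱼ, Wⱼₖ, Wₖᵢ)`, `(Zᵢⱼ, Zⱼₖ, Zₖᵢ)` annihilate `(cᵢ - cⱼ, cⱼ - cₖ, cₖ - cᵢ)`. -/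
theorem manakovCondition_of_isCompatible {c : Fin n → ℝ} {W Z : Fin n → Fin n → ℝ}
    {b d : Fin n → ℝ} (hW : IsCompatible c W b) (hZ : IsCompatible c Z d)
    (h : ∀ i j k, c i = c j → c j = c k → W i j * Z j k + W j k * Z k i + W k i * Z i j =
      Z i j * W j k + Z j k * W k i + Z k i * W i j) : ManakovCondition W Z := by
  intro i j k
  have w := hW.rel i j
  have w' := hW.rel j k
  have w'' := hW.rel k i
  have z := hZ.rel i j
  have z' := hZ.rel j k
  have z'' := hZ.rel k i
  by_cases hij : c i = c j
  · by_cases hjk : c j = c k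
    · exact h i j k hij hjk
    · refine mul_left_cancel₀ (sub_ne_zero.2 hjk) ?_
      linear_combination (Z k i - Z i j) * (w + w' + w'') + (W i j - W k i) * (z + z' + z'')
  · refine mul_left_cancel₀ (sub_ne_zero.2 hij) ?_
    linear_combination (Z j k - Z k i) * (w + w' + w'') + (W k i - W j k) * (z + z' + z'')

theorem manakovCondition_weights (k l : Fin n) :
    ManakovCondition (momWeight a k) (momWeight a l) := by
  refine manakovCondition_of_isCompatible (isCompatible_weights k) (isCompatible_weights l) ?_
  intro p q r hpq hqr
  have hpq : a p = a q := inv_injective hpq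
  have hqr : a q = a r := inv_injective hqr
  have hrp : a r = a p := (hpq.trans hqr).symm
  by_cases hk : IsBlockFirst a k
  · simp [momWeight_of_first_of_eq hk hpq, momWeight_of_first_of_eq hk hqr,
      momWeight_of_first_of_eq hk hrp]
  by_cases hl : IsBlockFirst a l
  · simp [momWeight_of_first_of_eq hl hpq, momWeight_of_first_of_eq hl hqr,
      momWeight_of_first_of_eq hl hrp]
  simp only [momWeight, hk, hl, if_false, hpq, hqr]
  by_cases hrk : a r = a k
  · by_cases hrl : a r = a l
    · simp only [hrk, ← hrl, true_and]
      by_cases h1 : p ≤ k <;> by_cases h2 : q ≤ k <;> by_cases h3 : r ≤ k <;>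
        by_cases h4 : p ≤ l <;> by_cases h5 : q ≤ l <;> by_cases h6 : r ≤ l <;>
        simp only [h1, h2, h3, h4, h5, h6] <;> norm_num <;> omega
    · simp [hrl]
  · simp [hrk]

/-! ### Functional independence -/

theorem momGrad_add_smul (W : Fin n → Fin n → ℝ) (u v w : Fin n → ℝ) (s : ℝ) :
    momGrad W u (v + s • w) = momGrad W u v + s • momGrad W u w := by
  funext i
  simp only [momGrad, angMom, Pi.add_apply, Pi.smul_apply, smul_eq_mul, Finset.mul_sum,
    ← Finset.sum_add_distrib]
  exact Finset.sum_congr rfl fun j _ => by ring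

theorem sum_mul_momGrad {W : Fin n → Fin n → ℝ} (hW : ∀ i j, W i j = W j i) (u v : Fin n → ℝ) :
    ∑ i, u i * momGrad W u v i = 0 := by
  simp only [momGrad, Finset.mul_sum]
  refine sum_sum_eq_zero_of_antisymm fun i j => ?_
  rw [hW j i]; simp only [angMom]; ring

/-- On a line in the direction of a linearly independent family, linear independence fails only at
the finitely many roots of a characteristic polynomial. -/
theorem finite_setOf_not_linearIndependent_add_smul {V : Type*} [AddCommGroup V] [Module ℝ V]
    {m : ℕ} {X : Fin m → V} (hX : LinearIndependent ℝ X) (Y : Fin m → V) :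
    {s : ℝ | ¬LinearIndependent ℝ fun k => Y k + s • X k}.Finite := by
  obtain ⟨φ, hφ⟩ := (Fintype.linearCombination ℝ X).exists_leftInverse_of_injective
    (LinearMap.ker_eq_bot.2 (linearIndependent_iff_injective_fintypeLinearCombination.1 hX))
  have hφX (k : Fin m) : φ (X k) = Pi.single k 1 := by
    have := LinearMap.congr_fun hφ (Pi.single k 1)
    simpa [Fintype.linearCombination_apply_single] using this
  let B : Matrix (Fin m) (Fin m) ℝ := fun k => φ (Y k)
  refine ((-B).charpoly.roots.toFinset.finite_toSet).subset fun s hs => ?_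
  simp only [Finset.mem_coe, Multiset.mem_toFinset]
  rw [Polynomial.mem_roots (Matrix.charpoly_monic _).ne_zero, Polynomial.IsRoot.def,
    Matrix.eval_charpoly]
  by_contra hdet
  refine hs (LinearIndependent.of_comp φ ?_)
  have hrow : (φ ∘ fun k => Y k + s • X k) = (Matrix.scalar (Fin m) s - -B).row := by
    funext k j
    have : (-B) k j = -φ (Y k) j := rfl
    simp [this, hφX, Matrix.row, Matrix.scalar_apply, Matrix.diagonal_apply, Pi.single_apply,
      add_comm, eq_comm]
  rw [hrow, Matrix.linearIndependent_rows_iff_isUnit, Matrix.isUnit_iff_isUnit_det]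
  exact isUnit_iff_ne_zero.2 hdet

open Classical in
/-- The signed displacement of the index `i` from the mean index of its block, for the weights `uⱼ²`. -/
def blockShift (a u : Fin n → ℝ) (i : Fin n) : ℝ :=
  (∑ j, (if a j = a i then u j ^ 2 * ((i : ℝ) - (j : ℝ)) else 0)) /
    ∑ j, if a j = a i then u j ^ 2 else 0

open Classical in
theorem blockMass_pos {u : Fin n → ℝ} (hu : ∀ i, u i ≠ 0) (i : Fin n) :
    0 < ∑ j, if a j = a i then u j ^ 2 else 0 :=
  Finset.sum_pos' (fun j _ => by split_ifs <;> positivity)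
    ⟨i, Finset.mem_univ i, by rw [if_pos rfl]; exact sq_pos_of_ne_zero (hu i)⟩

theorem blockShift_sub {u : Fin n → ℝ} (hu : ∀ i, u i ≠ 0) {i k : Fin n} (h : a i = a k) :
    blockShift a u i - blockShift a u k = (i : ℝ) - (k : ℝ) := by
  classical
  have hpos := (blockMass_pos (a := a) hu k).ne'
  rw [blockShift, blockShift, h, ← sub_div, ← Finset.sum_sub_distrib, div_eq_iff hpos,
    Finset.mul_sum]
  refine Finset.sum_congr rfl fun j _ => ?_
  split_ifs <;> ring

theorem sum_mul_blockShift {u φ : Fin n → ℝ} (hφ : ∀ i j, a i = a j → φ i = φ j) :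
    ∑ i, φ i * u i ^ 2 * blockShift a u i = 0 := by
  classical
  simp only [blockShift, Finset.sum_div, Finset.mul_sum]
  refine sum_sum_eq_zero_of_antisymm fun i j => ?_
  by_cases h : a i = a j
  · rw [if_pos h, if_pos h.symm, hφ i j h, h]; ring
  · rw [if_neg h, if_neg (Ne.symm h)]; ring

/-- The weights `Wᵢⱼ - ∑ bₗ uₗ²` which govern the fibre derivative of the `k`-th integral. -/
def fibreWeight (a u : Fin n → ℝ) (k i j : Fin n) : ℝ :=
  momWeight a k i j - ∑ l, posWeight a k l * u l ^ 2

theorem fibreWeight_symm (a u : Fin n → ℝ) (k i j : Fin n) :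
    fibreWeight a u k i j = fibreWeight a u k j i := by
  rw [fibreWeight, fibreWeight, (isCompatible_weights k).symm]

/-- Over a point with nonzero coordinates, the fibre derivatives of the integrals are linearly
independent at `vᵢ = uᵢ zᵢ` for a suitable `z`. Subtracting the mean from `i ↦ i` in each block
leaves only the index `o` to contribute to the equations for the block integrals, while
monotonicity of `z` in each block makes the remaining integrals a triangular system. -/
theorem exists_linearIndependent_momGrad (ha : ∀ i, 0 < a i) {u : Fin n → ℝ} (hu : ∀ i, u i ≠ 0)
    (hsum : ∑ i, (a i)⁻¹ * u i ^ 2 = 1) {m : ℕ} {κ : Fin m → Fin n} (hκ : StrictMono κ)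
    {o : Fin n} (ho : ∀ k, o < κ k) :
    ∃ v : Fin n → ℝ, LinearIndependent ℝ fun k => momGrad (fibreWeight a u (κ k)) u v := by
  classical
  set z : Fin n → ℝ := fun i => blockShift a u i - if i = o then 1 else 0 with hz
  have hL (i j : Fin n) : angMom u (fun i => u i * z i) i j = u i * u j * (z j - z i) := by
    simp only [angMom]; ring
  have hmean (φ : Fin n → ℝ) (hφ : ∀ i j, a i = a j → φ i = φ j) :
      ∑ i, φ i * u i ^ 2 * z i = -(φ o * u o ^ 2) := by
    simp only [hz, mul_sub, Finset.sum_sub_distrib, sum_mul_blockShift hφ]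
    simp
  refine ⟨fun i => u i * z i, Fintype.linearIndependent_iff.2 fun g hg => ?_⟩
  have hcomp (j : Fin n) :
      ∑ k, g k * momGrad (fibreWeight a u (κ k)) u (fun i => u i * z i) j = 0 := by
    have := congrFun hg j
    simpa [Finset.sum_apply] using this
  set Λ : Fin n → ℝ := fun i => ∑ k, g k * posWeight a (κ k) i with hΛ
  set T : Fin n → Fin n → ℝ := fun i j => ∑ k, g k * momWeight a (κ k) i j with hT
  set Q : ℝ := ∑ i, Λ i * u i ^ 2 with hQ
  have hΛc (i j : Fin n) (h : a i = a j) : Λ i = Λ j :=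
    Finset.sum_congr rfl fun k _ => by rw [posWeight_congr (κ k) h]
  have hTs (i j : Fin n) : T i j = T j i :=
    Finset.sum_congr rfl fun k _ => by rw [(isCompatible_weights (κ k)).symm]
  have hTrel (i j : Fin n) : ((a i)⁻¹ - (a j)⁻¹) * T i j = Λ i - Λ j := by
    simp only [hT, hΛ, Finset.mul_sum, ← Finset.sum_sub_distrib]
    refine Finset.sum_congr rfl fun k _ => ?_
    have := (isCompatible_weights (a := a) (κ k)).rel i j
    linear_combination g k * this
  have hQ' : Q = ∑ k, g k * ∑ l, posWeight a (κ k) l * u l ^ 2 := by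
    simp only [hQ, hΛ, Finset.sum_mul, Finset.mul_sum]
    rw [Finset.sum_comm]
    exact Finset.sum_congr rfl fun k _ => Finset.sum_congr rfl fun l _ => by ring
  have hΛo : Λ o = 0 := by
    refine Finset.sum_eq_zero fun k _ => ?_
    have : ¬(IsBlockFirst a (κ k) ∧ a o = a (κ k)) := fun h => h.1 o (ho k) h.2
    rw [posWeight, if_neg this, mul_zero]
  have hrow (j : Fin n) : ∑ i, (T j i - Q) * (u j * u i ^ 2 * (z i - z j)) = 0 := by
    have h1 := hcomp j
    have h2 : ∑ k, g k * momGrad (fibreWeight a u (κ k)) u (fun i => u i * z i) j =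
        -2 * ∑ i, (T j i - Q) * (u j * u i ^ 2 * (z i - z j)) := by
      simp only [hT, hQ', ← Finset.sum_sub_distrib, Finset.sum_mul]
      rw [Finset.sum_comm, Finset.mul_sum]
      refine Finset.sum_congr rfl fun k _ => ?_
      simp only [momGrad, fibreWeight, hL, Finset.mul_sum]
      refine Finset.sum_congr rfl fun i _ => ?_
      rw [← Finset.mul_sum]; ring
    linarith
  -- Pairing with the restriction of `u` to the block of `j₀` annihilates the block's own rotations.
  have hΛ1 (j₀ : Fin n) : Λ j₀ = ((a j₀)⁻¹ - (a o)⁻¹) * Q := by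
    by_cases hj₀ : a j₀ = a o
    · rw [hΛc j₀ o hj₀, hΛo, hj₀]; ring
    set φ : Fin n → ℝ := fun i => if a i = a j₀ then 0 else
      (Λ j₀ - Λ i) / ((a j₀)⁻¹ - (a i)⁻¹) - Q with hφ
    have hφc (i j : Fin n) (h : a i = a j) : φ i = φ j := by
      simp only [hφ]; rw [hΛc i j h, h]
    set B : Fin n → ℝ := fun i => if a i = a j₀ then 1 else 0 with hB
    have hBc (i j : Fin n) (h : a i = a j) : B i = B j := by
      simp only [hB]; rw [h]
    have hBo : B o = 0 := if_neg (Ne.symm hj₀)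
    have hTφ (i j : Fin n) (hj : a j = a j₀) (hi : a i ≠ a j₀) : T j i - Q = φ i := by
      have hne : (a j₀)⁻¹ - (a i)⁻¹ ≠ 0 := sub_ne_zero.2 fun h => hi (inv_injective h).symm
      simp only [hφ, if_neg hi]
      rw [sub_left_inj, eq_div_iff hne, ← hj, ← hΛc j j₀ hj, ← hTrel]; ring
    have h1 : ∑ j, ∑ i, (B j * u j * ((T j i - Q) * (u j * u i ^ 2 * (z i - z j)))
        - B j * u j * (φ i * (u j * u i ^ 2 * (z i - z j)))) = 0 := by
      refine sum_sum_eq_zero_of_antisymm fun j i => ?_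
      by_cases hj : a j = a j₀ <;> by_cases hi : a i = a j₀
      · simp only [hB, hφ, if_pos hj, if_pos hi, hTs i j]; ring
      · simp only [hTφ i j hj hi, hB, if_neg hi]; ring
      · simp only [hTφ j i hi hj, hB, if_neg hj]; ring
      · simp only [hB, if_neg hi, if_neg hj]; ring
    simp only [Finset.sum_sub_distrib, ← Finset.mul_sum, hrow, mul_zero, zero_sub] at h1
    rw [Finset.sum_neg_distrib, neg_eq_zero] at h1
    have h2 : ∑ j, B j * u j * ∑ i, φ i * (u j * u i ^ 2 * (z i - z j)) =
        (∑ j, B j * u j ^ 2) * (∑ i, φ i * u i ^ 2 * z i)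
        - (∑ j, B j * u j ^ 2 * z j) * (∑ i, φ i * u i ^ 2) := by
      rw [Finset.sum_mul_sum, Finset.sum_mul_sum, ← Finset.sum_sub_distrib]
      refine Finset.sum_congr rfl fun j _ => ?_
      rw [Finset.mul_sum, ← Finset.sum_sub_distrib]
      exact Finset.sum_congr rfl fun i _ => by ring
    rw [h2, hmean φ hφc, hmean B hBc, hBo] at h1
    have hmass : (∑ j, B j * u j ^ 2) ≠ 0 := by
      have := (blockMass_pos (a := a) hu j₀).ne'
      simpa [hB, ite_mul] using this
    have hφo : φ o = 0 := by
      have : (∑ j, B j * u j ^ 2) * u o ^ 2 * φ o = 0 := by linear_combination -h1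
      exact (mul_eq_zero.1 this).resolve_left (mul_ne_zero hmass (pow_ne_zero 2 (hu o)))
    have hne : (a j₀)⁻¹ - (a o)⁻¹ ≠ 0 := sub_ne_zero.2 fun h => hj₀ (inv_injective h)
    simp only [hφ, if_neg (Ne.symm hj₀), hΛo, sub_zero] at hφo
    rw [sub_eq_zero, div_eq_iff hne] at hφo
    rw [hφo]; ring
  -- Summing `Λᵢ uᵢ²` and using `∑ uᵢ² / aᵢ = 1` turns the last identity into an equation for `Q`.
  have hQ0 : Q = 0 := by
    have h1 : Q = Q - (a o)⁻¹ * (∑ i, u i ^ 2) * Q := by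
      have : ∑ i, Λ i * u i ^ 2 = Q * ∑ i, (a i)⁻¹ * u i ^ 2 - (a o)⁻¹ * (∑ i, u i ^ 2) * Q := by
        simp only [Finset.mul_sum, Finset.sum_mul, ← Finset.sum_sub_distrib]
        refine Finset.sum_congr rfl fun i _ => ?_
        rw [hΛ1 i]; ring
      rw [hsum, mul_one] at this
      exact this
    have h2 : 0 < ∑ i, u i ^ 2 :=
      Finset.sum_pos (fun i _ => sq_pos_of_ne_zero (hu i)) ⟨o, Finset.mem_univ o⟩
    have h3 : (a o)⁻¹ * (∑ i, u i ^ 2) * Q = 0 := by linarith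
    exact (mul_eq_zero.1 h3).resolve_left (mul_pos (inv_pos.2 (ha o)) h2).ne'
  have hfirst (k : Fin m) (hk : IsBlockFirst a (κ k)) : g k = 0 := by
    have h1 : Λ (κ k) = 0 := by rw [hΛ1, hQ0, mul_zero]
    have h2 : Λ (κ k) = g k := by
      have h3 : ∀ l ∈ Finset.univ, l ≠ k → g l * posWeight a (κ l) (κ k) = 0 := by
        intro l _ hl
        have : ¬(IsBlockFirst a (κ l) ∧ a (κ k) = a (κ l)) := by
          rintro ⟨hl1, hl2⟩
          rcases lt_trichotomy (κ l) (κ k) with h | h | h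
          · exact hk _ h hl2.symm
          · exact hl (hκ.injective h)
          · exact hl1 _ h hl2
        rw [posWeight, if_neg this, mul_zero]
      simp only [hΛ]
      rw [Finset.sum_eq_single k h3 (by simp), posWeight, if_pos ⟨hk, rfl⟩, mul_one]
    rw [← h2, h1]
  intro k
  -- The remaining integrals involve only indices up to `κ k`, so they are removed from the top down.
  induction k using WellFoundedGT.induction with
  | ind k ih =>
    by_cases hk : IsBlockFirst a (κ k)
    · exact hfirst k hk
    have hnf (l : Fin m) (hl : ¬IsBlockFirst a (κ l)) (i j : Fin n) :
        fibreWeight a u (κ l) i j =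
          if a i = a (κ l) ∧ a j = a (κ l) ∧ i ≤ κ l ∧ j ≤ κ l then 1 else 0 := by
      simp [fibreWeight, posWeight_of_not_first hl, momWeight, hl]
    have h1 := hcomp (κ k)
    rw [Finset.sum_eq_single k (fun l _ hl => ?_) (by simp)] at h1
    · refine (mul_eq_zero.1 h1).resolve_right ?_
      simp only [momGrad, hL, hnf k hk]
      simp only [IsBlockFirst, not_forall, not_not] at hk
      obtain ⟨j, hj, hja⟩ := hk
      refine mul_ne_zero (by norm_num) ?_
      have hko : κ k ≠ o := (ho k).ne'
      have hterm (i : Fin n) : (if True ∧ a i = a (κ k) ∧ κ k ≤ κ k ∧ i ≤ κ k then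
            (1 : ℝ) else 0) * (u (κ k) * u i * (z i - z (κ k))) * u i =
          -u (κ k) * if a i = a (κ k) ∧ i ≤ κ k then
            u i ^ 2 * (((κ k : ℕ) : ℝ) - ((i : ℕ) : ℝ) + if i = o then 1 else 0) else 0 := by
        by_cases hi : a i = a (κ k) ∧ i ≤ κ k
        · have h3 := blockShift_sub hu hi.1
          rw [if_pos ⟨trivial, hi.1, le_rfl, hi.2⟩, if_pos hi]
          simp only [hz, if_neg hko]
          linear_combination (u (κ k) * u i * u i) * h3
        · rw [if_neg fun h => hi ⟨h.2.1, h.2.2.2⟩, if_neg hi]; ring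
      rw [Finset.sum_congr rfl fun i _ => hterm i, ← Finset.mul_sum]
      refine mul_ne_zero (neg_ne_zero.2 (hu _)) (ne_of_gt ?_)
      refine Finset.sum_pos' (fun i _ => ?_) ⟨j, Finset.mem_univ j, ?_⟩
      · by_cases hi : a i = a (κ k) ∧ i ≤ κ k
        · rw [if_pos hi]
          have : ((i : ℕ) : ℝ) ≤ ((κ k : ℕ) : ℝ) := by exact_mod_cast hi.2
          refine mul_nonneg (sq_nonneg _) ?_
          split_ifs <;> linarith
        · rw [if_neg hi]
      · rw [if_pos ⟨hja, hj.le⟩]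
        have : ((j : ℕ) : ℝ) < ((κ k : ℕ) : ℝ) := by exact_mod_cast hj
        refine mul_pos (sq_pos_of_ne_zero (hu j)) ?_
        split_ifs <;> linarith
    · rcases lt_or_gt_of_ne hl with h | h
      · by_cases hl1 : IsBlockFirst a (κ l)
        · rw [hfirst l hl1, zero_mul]
        · have h2 : ∀ i, fibreWeight a u (κ l) (κ k) i = 0 := fun i => by
            rw [hnf l hl1, if_neg fun hh => absurd (hκ h) (not_lt.2 hh.2.2.1)]
          simp [momGrad, h2]
      · rw [ih l h, zero_mul]

/-- Independence of the fibre derivatives gives independence of the differentials on `T*S^{n-1}`.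
The direction `Aγ` is transversal to `T*_γ S^{n-1}` in `ℝⁿ`, and moving `p` in that direction does
not change the angular momenta. -/
theorem linearIndependent_fderiv_of_momGrad (ha : ∀ i, 0 < a i) {m : ℕ} (κ : Fin m → Fin n)
    {z : E n × E n} (hz : z ∈ cotangentSphere n)
    (h : LinearIndependent ℝ fun k => momGrad (fibreWeight a (scaledPos a z.1) (κ k))
      (scaledPos a z.1) (scaledMom a z.2)) :
    LinearIndependent ℝ fun k =>
      ((fderiv ℝ (quadIntegral a (momWeight a (κ k)) (posWeight a (κ k))) z :
        E n × E n →L[ℝ] ℝ) : E n × E n →ₗ[ℝ] ℝ).domRestrict (tangent z) := by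
  rw [Fintype.linearIndependent_iff] at h ⊢
  intro g hg
  refine h g ?_
  funext i
  have hN := inner_diagMul_self_pos ha (ne_zero_of_norm_eq_one hz.1)
  set s : ℝ := √(a i) * z.1 i / ⟪diagMul a z.1, z.1⟫_ℝ with hs
  have hη : ((0 : E n), EuclideanSpace.single i (√(a i)) - s • diagMul a z.1) ∈ tangent z := by
    refine ⟨inner_zero_right _, ?_⟩
    change ⟪z.1, _ - _⟫_ℝ + ⟪z.2, 0⟫_ℝ = 0
    simp only [inner_zero_right, add_zero, inner_sub_right, inner_smul_right,
      real_inner_comm (diagMul a z.1) z.1, hs]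
    rw [div_mul_cancel₀ _ hN.ne', inner_eq_sum]
    simp [mul_comm]
  have h1 := LinearMap.congr_fun hg ⟨_, hη⟩
  simp only [LinearMap.sum_apply, LinearMap.smul_apply, LinearMap.domRestrict_apply,
    ContinuousLinearMap.coe_coe, smul_eq_mul, LinearMap.zero_apply] at h1
  have hpos (j : Fin n) : scaledPos a (0 : E n) j = 0 := by simp [scaledPos]
  have hmom (j : Fin n) : scaledMom a (EuclideanSpace.single i (√(a i)) - s • diagMul a z.1) j =
      (if j = i then 1 else 0) - s * scaledPos a z.1 j := by
    have hj := (Real.sqrt_pos.2 (ha j)).ne'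
    have hsq : a j / √(a j) = √(a j) := Real.div_sqrt
    simp only [scaledMom, scaledPos, PiLp.sub_apply, PiLp.smul_apply, diagMul_apply, smul_eq_mul,
      sub_div]
    congr 1
    · by_cases hji : j = i
      · subst hji; simp [hj]
      · simp [hji]
    · rw [mul_div_assoc, mul_div_right_comm, hsq]
  have h2 (k : Fin m) : fderiv ℝ (quadIntegral a (momWeight a (κ k)) (posWeight a (κ k))) z
      (0, EuclideanSpace.single i (√(a i)) - s • diagMul a z.1) =
      momGrad (fibreWeight a (scaledPos a z.1) (κ k)) (scaledPos a z.1) (scaledMom a z.2) i := by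
    rw [fderiv_quadIntegral a (isCompatible_weights (κ k)).symm]
    have h3 := sum_mul_momGrad (fibreWeight_symm a (scaledPos a z.1) (κ k)) (scaledPos a z.1)
      (scaledMom a z.2)
    simp only [hpos, zero_mul, zero_add, hmom, sub_mul, Finset.sum_sub_distrib, ite_mul, one_mul]
    change _ - ∑ j, s * scaledPos a z.1 j * momGrad (fibreWeight a (scaledPos a z.1) (κ k))
      (scaledPos a z.1) (scaledMom a z.2) j = _
    simp only [mul_assoc, ← Finset.mul_sum, h3]
    simp
    rfl
  simp only [h2] at h1
  simpa [Finset.sum_apply] using h1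

/-- The points of `T*S^{n-1}` over the points of the sphere with nonzero coordinates are dense. -/
theorem cotangentSphere_subset_closure :
    cotangentSphere n ⊆ closure {z | z ∈ cotangentSphere n ∧ ∀ i, z.1 i ≠ 0} := by
  intro z hz
  let y : ℝ → E n := fun s => z.1 + s • WithLp.toLp 2 fun _ => (1 : ℝ)
  let x : ℝ → E n := fun s => ‖y s‖⁻¹ • y s
  let p : ℝ → E n := fun s => z.2 - ⟪x s, z.2⟫_ℝ • x s
  have hy : Continuous y := by fun_prop
  have hy0 : y 0 = z.1 := by simp [y]
  have hyn : ∀ᶠ s in nhds (0 : ℝ), y s ≠ 0 :=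
    hy.continuousAt.eventually_ne (by rw [hy0]; exact ne_zero_of_norm_eq_one hz.1)
  have hx : ContinuousAt x 0 := by
    refine ContinuousAt.smul (hy.norm.continuousAt.inv₀ ?_) hy.continuousAt
    rw [hy0, hz.1]; exact one_ne_zero
  have hx0 : x 0 = z.1 := by simp only [x]; rw [hy0, hz.1]; simp
  have hp : ContinuousAt p 0 :=
    continuousAt_const.sub ((hx.inner continuousAt_const).fun_smul hx)
  have hp0 : p 0 = z.2 := by simp only [p, hx0]; rw [hz.2]; simp
  have hlim : Filter.Tendsto (fun s => (x s, p s)) (nhdsWithin 0 {0}ᶜ) (nhds z) := by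
    have h := (hx.prodMk hp).tendsto
    rw [hx0, hp0] at h
    exact h.mono_left nhdsWithin_le_nhds
  refine mem_closure_of_tendsto hlim ?_
  have hfin : ∀ᶠ s in nhdsWithin (0 : ℝ) {0}ᶜ, ∀ i, y s i ≠ 0 := by
    rw [Filter.eventually_all]
    intro i
    by_cases hi : z.1 i = 0
    · filter_upwards [self_mem_nhdsWithin] with s hs
      simpa [y, hi] using hs
    · refine nhdsWithin_le_nhds ?_
      have hc : Continuous fun s => y s i := by simp only [y]; fun_prop
      refine hc.continuousAt.eventually_ne ?_
      simpa [y] using hi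
  filter_upwards [hfin, nhdsWithin_le_nhds hyn] with s hs hs0
  have hnorm : ‖x s‖ = 1 := by
    simp only [x]
    rw [norm_smul, norm_inv, norm_norm, inv_mul_cancel₀ (norm_ne_zero_iff.2 hs0)]
  refine ⟨⟨hnorm, ?_⟩, fun i => ?_⟩
  · simp only [p]
    rw [inner_sub_right, inner_smul_right, real_inner_self_eq_norm_sq, hnorm]; ring
  · simp only [x]
    exact mul_ne_zero (inv_ne_zero (norm_ne_zero_iff.2 hs0)) (hs i)

theorem functionallyIndependent_quadIntegral (ha : ∀ i, 0 < a i) {m : ℕ} {κ : Fin m → Fin n}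
    (hκ : StrictMono κ) {o : Fin n} (ho : ∀ k, o < κ k) :
    FunctionallyIndependent fun k => quadIntegral a (momWeight a (κ k)) (posWeight a (κ k)) := by
  refine cotangentSphere_subset_closure.trans (closure_minimal ?_ isClosed_closure)
  rintro z ⟨hz, hz0⟩
  have hu (i : Fin n) : scaledPos a z.1 i ≠ 0 :=
    mul_ne_zero (Real.sqrt_pos.2 (ha i)).ne' (hz0 i)
  have hsum : ∑ i, (a i)⁻¹ * scaledPos a z.1 i ^ 2 = 1 := by
    have h := sum_inv_mul_scaledPos ha z.1 z.1
    rw [real_inner_self_eq_norm_sq, hz.1, one_pow] at h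
    simpa only [sq] using h
  obtain ⟨v, hv⟩ := exists_linearIndependent_momGrad ha hu hsum hκ ho
  have hN := inner_diagMul_self_pos ha (ne_zero_of_norm_eq_one hz.1)
  -- The momentum with scaled coordinates `v`, moved into `T*_γ S^{n-1}` along `Aγ`.
  set w : E n := WithLp.toLp 2 fun i => √(a i) * v i with hw
  set r : ℝ := ⟪z.1, w⟫_ℝ / ⟪diagMul a z.1, z.1⟫_ℝ with hr
  have hmom : scaledMom a (w - r • diagMul a z.1) = v + (-r) • scaledPos a z.1 := by
    funext i
    have hi := (Real.sqrt_pos.2 (ha i)).ne'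
    have hsq : a i / √(a i) = √(a i) := Real.div_sqrt
    simp only [scaledMom, scaledPos, PiLp.sub_apply, PiLp.smul_apply, diagMul_apply, smul_eq_mul,
      sub_div, Pi.add_apply, Pi.smul_apply, hw]
    rw [mul_div_cancel_left₀ _ hi, mul_div_assoc, mul_div_right_comm, hsq]; ring
  have hself (W : Fin n → Fin n → ℝ) (u : Fin n → ℝ) : momGrad W u u = 0 := by
    funext i; simp [momGrad, angMom, mul_comm]
  have hline (s : ℝ) : scaledMom a (z.2 + s • (w - r • diagMul a z.1)) =
      scaledMom a z.2 + s • (v + (-r) • scaledPos a z.1) := by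
    funext i; rw [scaledMom_line, hmom]; rfl
  have hort : ⟪z.1, w - r • diagMul a z.1⟫_ℝ = 0 := by
    rw [inner_sub_right, inner_smul_right, real_inner_comm (diagMul a z.1), hr,
      div_mul_cancel₀ _ hN.ne', sub_self]
  have hfin := finite_setOf_not_linearIndependent_add_smul hv fun k =>
    momGrad (fibreWeight a (scaledPos a z.1) (κ k)) (scaledPos a z.1) (scaledMom a z.2)
  have hlim : Filter.Tendsto (fun s : ℝ => (z.1, z.2 + s • (w - r • diagMul a z.1)))
      (nhdsWithin 0 {0}ᶜ) (nhds z) := by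
    have h : Continuous fun s : ℝ => (z.1, z.2 + s • (w - r • diagMul a z.1)) := by fun_prop
    have h' := h.tendsto 0
    simp only [zero_smul, add_zero] at h'
    exact h'.mono_left nhdsWithin_le_nhds
  refine mem_closure_of_tendsto hlim ?_
  have hev : ∀ᶠ s in nhdsWithin (0 : ℝ) {0}ᶜ, s ∉ {s : ℝ | ¬LinearIndependent ℝ fun k =>
      momGrad (fibreWeight a (scaledPos a z.1) (κ k)) (scaledPos a z.1) (scaledMom a z.2)
        + s • momGrad (fibreWeight a (scaledPos a z.1) (κ k)) (scaledPos a z.1) v} := by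
    have := (hfin.inter_of_left {0}ᶜ).isClosed.isOpen_compl.mem_nhds (x := (0 : ℝ)) (by simp)
    filter_upwards [nhdsWithin_le_nhds this, self_mem_nhdsWithin] with s hs hs0 hmem
    exact hs ⟨hmem, hs0⟩
  filter_upwards [hev] with s hs
  have hmemz : (z.1, z.2 + s • (w - r • diagMul a z.1)) ∈ cotangentSphere n := by
    refine ⟨hz.1, ?_⟩
    simp only [inner_add_right, inner_smul_right, hort]
    rw [hz.2]; ring
  refine ⟨hmemz, linearIndependent_fderiv_of_momGrad ha κ hmemz ?_⟩
  simp only [not_not] at hs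
  simp only [hline, momGrad_add_smul, hself, smul_zero, add_zero]
  exact hs

theorem liouvilleIntegrable_hamiltonian (hn : 2 ≤ n) (ha : ∀ i, 0 < a i) :
    LiouvilleIntegrable (hamiltonian a) := by
  let κ : Fin (n - 1) → Fin n := fun k => ⟨k + 1, by omega⟩
  have hκ : StrictMono κ := fun k l h => by
    have : (k : ℕ) < l := h
    exact Fin.mk_lt_mk.2 (by omega)
  have ho (k : Fin (n - 1)) : (⟨0, by omega⟩ : Fin n) < κ k := Fin.mk_lt_mk.2 (by omega)
  refine ⟨fun k => quadIntegral a (momWeight a (κ k)) (posWeight a (κ k)),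
    fun k => contDiff_quadIntegral _ _ _, fun k => ?_, fun k l => ?_,
    functionallyIndependent_quadIntegral ha hκ ho⟩
  · rw [hamiltonian_eq_quadIntegral ha]
    refine inInvolution_quadIntegral ha ⟨fun _ _ => rfl, fun i j => by simp⟩
      (isCompatible_weights _) fun i j k => ?_
    simp
  · exact inInvolution_quadIntegral ha (isCompatible_weights _) (isCompatible_weights _)
      (manakovCondition_weights _ _)

/-! ### Change of time -/

/-- A continuous function on an open interval has an antiderivative. -/
theorem exists_hasDerivAt_of_continuousOn {I : Set ℝ} (hI : IsOpen I) (hc : I.OrdConnected)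
    {f : ℝ → ℝ} (hf : ContinuousOn f I) : ∃ s : ℝ → ℝ, ∀ t ∈ I, HasDerivAt s (f t) t := by
  rcases I.eq_empty_or_nonempty with rfl | ⟨t₀, ht₀⟩
  · exact ⟨f, fun t ht => ht.elim⟩
  · refine ⟨fun t => ∫ τ in t₀..t, f τ, fun t ht => ?_⟩
    exact intervalIntegral.integral_hasDerivAt_right
      (hf.mono (hc.uIcc_subset ht₀ ht)).intervalIntegrable
      (hf.stronglyMeasurableAtFilter hI t ht) (hf.continuousAt (hI.mem_nhds ht))

/-- A decreasing change of time on an open interval has a `C²` inverse. -/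
theorem exists_inverse_time {I : Set ℝ} (hI : IsOpen I) (hc : I.OrdConnected) {s f : ℝ → ℝ}
    (hs : ∀ t ∈ I, HasDerivAt s (f t) t) (hf : ContDiffOn ℝ 1 f I) (hneg : ∀ t ∈ I, f t < 0) :
    IsOpen (s '' I) ∧ (s '' I).OrdConnected ∧ ∃ g : ℝ → ℝ, (∀ t ∈ I, g (s t) = t) ∧
      ContDiffOn ℝ 2 g (s '' I) ∧ ∀ t ∈ I, HasDerivAt g (f t)⁻¹ (s t) := by
  have hcont : ContinuousOn s I := fun t ht => (hs t ht).continuousAt.continuousWithinAt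
  have hanti : StrictAntiOn s I := by
    refine strictAntiOn_of_deriv_neg hc.convex hcont fun t ht => ?_
    rw [hI.interior_eq] at ht
    rw [(hs t ht).deriv]; exact hneg t ht
  have hC2 : ContDiffOn ℝ 2 s I := by
    have h2 : (2 : WithTop ℕ∞) = 1 + 1 := by norm_num
    rw [h2, contDiffOn_succ_iff_deriv_of_isOpen hI]
    refine ⟨fun t ht => (hs t ht).differentiableAt.differentiableWithinAt, by simp, ?_⟩
    exact hf.congr fun t ht => (hs t ht).deriv
  have hleft (t : ℝ) (ht : t ∈ I) : Function.invFunOn s I (s t) = t :=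
    hanti.injOn (Function.invFunOn_mem ⟨t, ht, rfl⟩) ht (Function.invFunOn_eq ⟨t, ht, rfl⟩)
  have hloc (t : ℝ) (ht : t ∈ I) : s '' I ∈ nhds (s t) ∧
      ContDiffAt ℝ 2 (Function.invFunOn s I) (s t) := by
    have hat : ContDiffAt ℝ 2 s t := (hC2 t ht).contDiffAt (hI.mem_nhds ht)
    have hd : HasFDerivAt s
        (ContinuousLinearEquiv.unitsEquivAut ℝ (Units.mk0 (f t) (hneg t ht).ne) : ℝ →L[ℝ] ℝ) t :=
      (hs t ht).hasFDerivAt_equiv (hneg t ht).ne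
    have h2 : (2 : WithTop ℕ∞) ≠ 0 := by norm_num
    have hinv := hat.to_localInverse hd h2
    have hcontinv := hinv.continuousAt.tendsto
    rw [hat.localInverse_apply_image hd h2] at hcontinv
    have hright : ∀ᶠ y in nhds (s t), s (hat.localInverse hd h2 y) = y :=
      (hat.hasStrictFDerivAt' hd h2).eventually_right_inverse
    have hmem : ∀ᶠ y in nhds (s t), hat.localInverse hd h2 y ∈ I :=
      hcontinv.eventually (hI.mem_nhds ht)
    refine ⟨?_, hinv.congr_of_eventuallyEq ?_⟩
    · filter_upwards [hright, hmem] with y h1 h2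
      exact ⟨_, h2, h1⟩
    · filter_upwards [hright, hmem] with y h1 h2
      rw [← h1, hleft _ h2, h1]
  have hopen : IsOpen (s '' I) := by
    rw [isOpen_iff_mem_nhds]
    rintro _ ⟨t, ht, rfl⟩
    exact (hloc t ht).1
  refine ⟨hopen, ((isPreconnected_iff_ordConnected.2 hc).image s hcont).ordConnected,
    Function.invFunOn s I, hleft, ?_, fun t ht => ?_⟩
  · rintro _ ⟨t, ht, rfl⟩
    exact (hloc t ht).2.contDiffWithinAt
  · refine HasDerivAt.of_local_left_inverse (f := s) (hloc t ht).2.continuousAt ?_ (hneg t ht).ne ?_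
    · rw [hleft t ht]; exact hs t ht
    · filter_upwards [(hloc t ht).1] with y hy
      exact Function.invFunOn_eq hy

/-! ### The Neumann system -/

theorem gradient_neumannPotential (a : Fin n → ℝ) (x : E n) :
    gradient (neumannPotential a) x = -(2 : ℝ) • diagMul (fun i => (a i)⁻¹) x := by
  refine HasGradientAt.gradient ?_
  rw [hasGradientAt_iff_hasFDerivAt]
  have h : HasFDerivAt (neumannPotential a) _ x :=
    (((diagCLM fun i => (a i)⁻¹).hasFDerivAt (x := x)).inner ℝ (hasFDerivAt_id x)).neg
  refine h.congr_fderiv ?_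
  ext y
  simp only [neg_apply, ContinuousLinearMap.comp_apply,
    ContinuousLinearMap.prod_apply, fderivInnerCLM_apply, InnerProductSpace.toDual_apply_apply,
    diagCLM_apply, ContinuousLinearMap.id_apply, inner_smul_left, conj_trivial, id]
  rw [inner_diagMul_comm _ y]
  ring

theorem quadForm_pos (ha : ∀ i, 0 < a i) {γ : ℝ → E n} {I : Set ℝ} (h : IsSphereCurve γ I) {t : ℝ}
    (ht : t ∈ I) : 0 < ⟪diagMul a (γ t), γ t⟫_ℝ :=
  inner_diagMul_self_pos ha (ne_zero_of_norm_eq_one (h.norm_eq_one t ht))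

theorem diagMul_sqrt_inner (ha : ∀ i, 0 < a i) (X Y : E n) :
    ⟪diagMul (fun i => √(a i)) X, diagMul (fun i => √(a i)) Y⟫_ℝ = ⟪diagMul a X, Y⟫_ℝ := by
  simp only [inner_eq_sum, diagMul_apply]
  refine Finset.sum_congr rfl fun i _ => ?_
  linear_combination (X i * Y i) * Real.mul_self_sqrt (ha i).le

theorem norm_sphereMap (ha : ∀ i, 0 < a i) {γ : E n} (hγ : γ ≠ 0) : ‖sphereMap a γ‖ = 1 := by
  have hN := inner_diagMul_self_pos ha hγ
  have h : ⟪sphereMap a γ, sphereMap a γ⟫_ℝ = 1 := by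
    rw [sphereMap, inner_smul_left, inner_smul_right, diagMul_sqrt_inner ha, conj_trivial]
    have := Real.mul_self_sqrt hN.le
    have := (Real.sqrt_pos.2 hN).ne'
    field_simp
    linarith
  rw [real_inner_self_eq_norm_sq] at h
  exact (pow_eq_one_iff_of_nonneg (norm_nonneg _) two_ne_zero).1 h

theorem invForm_sphereMap (ha : ∀ i, 0 < a i) {γ : E n} (hγ : ‖γ‖ = 1) :
    invForm a (sphereMap a γ) = (⟪diagMul a γ, γ⟫_ℝ)⁻¹ := by
  have hN := inner_diagMul_self_pos ha (ne_zero_of_norm_eq_one hγ)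
  have h : ⟪diagMul (fun i => (a i)⁻¹) (diagMul (fun i => √(a i)) γ),
      diagMul (fun i => √(a i)) γ⟫_ℝ = ⟪γ, γ⟫_ℝ := by
    simp only [inner_eq_sum, diagMul_apply]
    refine Finset.sum_congr rfl fun i _ => ?_
    have := (ha i).ne'
    field_simp
    linear_combination (γ i * γ i) * Real.mul_self_sqrt (ha i).le
  rw [invForm, sphereMap, diagMul_smul, inner_smul_left, inner_smul_right, h,
    real_inner_self_eq_norm_sq, hγ, conj_trivial, ← mul_assoc, ← mul_inv, Real.mul_self_sqrt hN.le]
  norm_num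

theorem sqrt_invForm_sphereMap (ha : ∀ i, 0 < a i) {γ : E n} (hγ : ‖γ‖ = 1) :
    √(invForm a (sphereMap a γ)) = (√⟪diagMul a γ, γ⟫_ℝ)⁻¹ := by
  rw [invForm_sphereMap ha hγ, Real.sqrt_inv]

/-- The acceleration along a solution, with the Lagrange multiplier `(Aγ, γ)(Aγ̇, γ̇) - (Aγ, γ̇)²`
found by pairing the equation with `γ`. -/
theorem IsSpecialMotion.acceleration {γ : ℝ → E n} {I : Set ℝ}
    (h : IsSpecialMotion (-1) a γ I) {t : ℝ} (ht : t ∈ I) :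
    ⟪diagMul a (γ t), γ t⟫_ℝ • diagMul a (deriv (deriv γ) t) =
      (⟪diagMul a (γ t), deriv (deriv γ) t⟫_ℝ - ⟪diagMul a (deriv γ t), deriv γ t⟫_ℝ) •
        diagMul a (γ t)
      + ⟪diagMul a (γ t), deriv γ t⟫_ℝ • diagMul a (deriv γ t)
      + (⟪diagMul a (γ t), γ t⟫_ℝ * ⟪diagMul a (deriv γ t), deriv γ t⟫_ℝ
        - ⟪diagMul a (γ t), deriv γ t⟫_ℝ ^ 2) • γ t := by
  obtain ⟨lam, hlam⟩ := h.eq_motion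
  have h1 := h.toIsSphereCurve.hasDerivAt ht
  have h2 := h.toIsSphereCurve.hasDerivAt_deriv ht
  have hγγ := h.toIsSphereCurve.inner_self ht
  have hder := (((h1.diagMul a).inner ℝ h2).fun_smul (h1.diagMul a)).fun_sub
    ((hasDerivAt_quadForm a h1).fun_smul (h2.diagMul a))
  have heq := hlam t ht
  rw [hder.deriv] at heq
  have heq' : ⟪diagMul a (γ t), γ t⟫_ℝ • diagMul a (deriv (deriv γ) t) =
      (⟪diagMul a (γ t), deriv (deriv γ) t⟫_ℝ - ⟪diagMul a (deriv γ t), deriv γ t⟫_ℝ) •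
        diagMul a (γ t)
      + ⟪diagMul a (γ t), deriv γ t⟫_ℝ • diagMul a (deriv γ t) + lam t • γ t := by
    rw [← sub_eq_zero] at heq ⊢
    rw [← heq]
    module
  have hl := congrArg (fun V => ⟪V, γ t⟫_ℝ) heq'
  simp only [inner_add_left, inner_smul_left, conj_trivial, hγγ] at hl
  rw [inner_diagMul_comm a (deriv (deriv γ) t), inner_diagMul_comm a (deriv γ t) (γ t)] at hl
  have : lam t = ⟪diagMul a (γ t), γ t⟫_ℝ * ⟪diagMul a (deriv γ t), deriv γ t⟫_ℝ
        - ⟪diagMul a (γ t), deriv γ t⟫_ℝ ^ 2 := by linear_combination -hl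
  rw [heq', this]

/-- The velocity, in the time `ds = -(Aγ, γ)^{-1/2} dt`, of the image of `γ` under `sphereMap`. -/
def neumannVelocity (a : Fin n → ℝ) (γ : ℝ → E n) (t : ℝ) : E n :=
  (⟪diagMul a (γ t), deriv γ t⟫_ℝ / ⟪diagMul a (γ t), γ t⟫_ℝ) • diagMul (fun i => √(a i)) (γ t)
    - diagMul (fun i => √(a i)) (deriv γ t)

theorem hasDerivAt_sphereMap (ha : ∀ i, 0 < a i) {γ : ℝ → E n} {I : Set ℝ}
    (h : IsSphereCurve γ I) {t : ℝ} (ht : t ∈ I) :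
    HasDerivAt (fun τ => sphereMap a (γ τ))
      (-(√⟪diagMul a (γ t), γ t⟫_ℝ)⁻¹ • neumannVelocity a γ t) t := by
  have hN := quadForm_pos ha h ht
  have hr := (Real.sqrt_pos.2 hN).ne'
  have h1 := h.hasDerivAt ht
  refine ((((hasDerivAt_quadForm a h1).sqrt hN.ne').fun_inv hr).fun_smul
    (h1.diagMul fun i => √(a i))).congr_deriv ?_
  rw [neumannVelocity, smul_sub, smul_smul, Real.sq_sqrt hN.le]
  have : -(2 * ⟪diagMul a (γ t), deriv γ t⟫_ℝ / (2 * √⟪diagMul a (γ t), γ t⟫_ℝ)) /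
      ⟪diagMul a (γ t), γ t⟫_ℝ = -(√⟪diagMul a (γ t), γ t⟫_ℝ)⁻¹ *
        (⟪diagMul a (γ t), deriv γ t⟫_ℝ / ⟪diagMul a (γ t), γ t⟫_ℝ) := by
    field_simp
  rw [this]
  module

theorem hasDerivAt_neumannVelocity (ha : ∀ i, 0 < a i) {γ : ℝ → E n} {I : Set ℝ}
    (h : IsSpecialMotion (-1) a γ I) {t : ℝ} (ht : t ∈ I)
    (hE : ⟪diagMul a (γ t), γ t⟫_ℝ * ⟪diagMul a (deriv γ t), deriv γ t⟫_ℝ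
      - ⟪diagMul a (γ t), deriv γ t⟫_ℝ ^ 2 = 2) :
    ∃ r : ℝ, HasDerivAt (neumannVelocity a γ)
      (-(√⟪diagMul a (γ t), γ t⟫_ℝ)⁻¹ • ((2 : ℝ) • diagMul (fun i => (a i)⁻¹) (sphereMap a (γ t))
        + r • sphereMap a (γ t))) t := by
  have hN := quadForm_pos ha h.toIsSphereCurve ht
  have h1 := h.toIsSphereCurve.hasDerivAt ht
  have h2 := h.toIsSphereCurve.hasDerivAt_deriv ht
  have hacc := h.acceleration ht
  rw [hE] at hacc
  obtain ⟨q', hq⟩ : ∃ q' : ℝ, HasDerivAt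
      (fun τ => ⟪diagMul a (γ τ), deriv γ τ⟫_ℝ / ⟪diagMul a (γ τ), γ τ⟫_ℝ) q' t :=
    ⟨_, ((h1.diagMul a).inner ℝ h2).fun_div (hasDerivAt_quadForm a h1) hN.ne'⟩
  have hd := (hq.fun_smul (h1.diagMul fun i => √(a i))).fun_sub (h2.diagMul fun i => √(a i))
  set N := ⟪diagMul a (γ t), γ t⟫_ℝ with hNdef
  set e := ⟪diagMul a (γ t), deriv (deriv γ) t⟫_ℝ - ⟪diagMul a (deriv γ t), deriv γ t⟫_ℝ with he
  refine ⟨e - N * q', hd.congr_deriv ?_⟩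
  have hs := Real.mul_self_sqrt hN.le
  have hr := (Real.sqrt_pos.2 hN).ne'
  have hinv : (√N)⁻¹ * (√N)⁻¹ = N⁻¹ := by rw [← mul_inv, hs]
  ext i
  have hai := (ha i).ne'
  have hcomp := congrFun (congrArg WithLp.ofLp hacc) i
  simp only [PiLp.add_apply, PiLp.sub_apply, PiLp.smul_apply, diagMul_apply, smul_eq_mul,
    sphereMap, ← hNdef] at hcomp ⊢
  have hγ'' : deriv (deriv γ) t i = N⁻¹ * (e * γ t i
      + ⟪diagMul a (γ t), deriv γ t⟫_ℝ * deriv γ t i + 2 * (a i)⁻¹ * γ t i) := by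
    field_simp
    linear_combination hcomp
  rw [hγ'']
  have hNN : N⁻¹ * N = 1 := inv_mul_cancel₀ hN.ne'
  rw [div_eq_mul_inv]
  linear_combination ((2 * (a i)⁻¹ + e - N * q') * √(a i) * γ t i) * hinv
    - (q' * √(a i) * γ t i) * hNN

theorem contDiffOn_sphereMap (ha : ∀ i, 0 < a i) {γ : ℝ → E n} {I : Set ℝ}
    (h : IsSphereCurve γ I) : ContDiffOn ℝ 2 (fun t => sphereMap a (γ t)) I := by
  have hN : ContDiffOn ℝ 2 (fun t => ⟪diagMul a (γ t), γ t⟫_ℝ) I :=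
    ((contDiff_diagMul a).comp_contDiffOn h.contDiffOn).inner ℝ h.contDiffOn
  refine ContDiffOn.smul ((hN.sqrt fun t ht => (quadForm_pos ha h ht).ne').inv fun t ht => ?_)
    ((contDiff_diagMul _).comp_contDiffOn h.contDiffOn)
  exact (Real.sqrt_pos.2 (quadForm_pos ha h ht)).ne'

theorem norm_sq_neumannVelocity (ha : ∀ i, 0 < a i) {γ : ℝ → E n} {I : Set ℝ}
    (h : IsSphereCurve γ I) {t : ℝ} (ht : t ∈ I) :
    ‖neumannVelocity a γ t‖ ^ 2 = (⟪diagMul a (γ t), γ t⟫_ℝ *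
      ⟪diagMul a (deriv γ t), deriv γ t⟫_ℝ - ⟪diagMul a (γ t), deriv γ t⟫_ℝ ^ 2) *
        (⟪diagMul a (γ t), γ t⟫_ℝ)⁻¹ := by
  have hN := (quadForm_pos ha h ht).ne'
  rw [← real_inner_self_eq_norm_sq, neumannVelocity]
  simp only [inner_sub_left, inner_sub_right, inner_smul_left, inner_smul_right,
    diagMul_sqrt_inner ha, conj_trivial]
  rw [inner_diagMul_comm a (deriv γ t) (γ t)]
  field_simp
  ring

/-- Solutions of energy `1` become zero-energy Neumann trajectories in the time `s`. -/
theorem IsSpecialMotion.neumann (ha : ∀ i, 0 < a i) {γ : ℝ → E n} {I : Set ℝ}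
    (h : IsSpecialMotion (-1) a γ I)
    (hE : ∀ t ∈ I, ⟪diagMul a (γ t), γ t⟫_ℝ * ⟪diagMul a (deriv γ t), deriv γ t⟫_ℝ
      - ⟪diagMul a (γ t), deriv γ t⟫_ℝ ^ 2 = 2) :
    (∃ s : ℝ → ℝ, ∀ t ∈ I, HasDerivAt s (-√(invForm a (sphereMap a (γ t)))) t) ∧
      ∀ s : ℝ → ℝ, (∀ t ∈ I, HasDerivAt s (-√(invForm a (sphereMap a (γ t)))) t) →
        ∃ x : ℝ → E n, (∀ t ∈ I, x (s t) = sphereMap a (γ t)) ∧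
          IsNaturalTrajectory (neumannPotential a) x (s '' I) ∧
          ∀ u ∈ s '' I, 1 / 2 * ‖deriv x u‖ ^ 2 + neumannPotential a (x u) = 0 := by
  have hc := h.toIsSphereCurve
  have hrate (t : ℝ) (ht : t ∈ I) : -√(invForm a (sphereMap a (γ t))) =
      -(√⟪diagMul a (γ t), γ t⟫_ℝ)⁻¹ := by
    rw [sqrt_invForm_sphereMap ha (hc.norm_eq_one t ht)]
  have hsmooth : ContDiffOn ℝ 1 (fun t => -(√⟪diagMul a (γ t), γ t⟫_ℝ)⁻¹) I := by
    have hγ : ContDiffOn ℝ 1 γ I := hc.contDiffOn.of_le (by norm_num)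
    have hN : ContDiffOn ℝ 1 (fun t => ⟪diagMul a (γ t), γ t⟫_ℝ) I :=
      ((contDiff_diagMul a).comp_contDiffOn hγ).inner ℝ hγ
    refine ((hN.sqrt fun t ht => (quadForm_pos ha hc ht).ne').inv fun t ht => ?_).neg
    exact (Real.sqrt_pos.2 (quadForm_pos ha hc ht)).ne'
  have hneg (t : ℝ) (ht : t ∈ I) : -(√⟪diagMul a (γ t), γ t⟫_ℝ)⁻¹ < 0 :=
    neg_neg_of_pos (inv_pos.2 (Real.sqrt_pos.2 (quadForm_pos ha hc ht)))
  refine ⟨?_, fun s hs => ?_⟩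
  · obtain ⟨s, hs⟩ :=
      exists_hasDerivAt_of_continuousOn hc.isOpen hc.ordConnected hsmooth.continuousOn
    exact ⟨s, fun t ht => by rw [hrate t ht]; exact hs t ht⟩
  · have hs' : ∀ t ∈ I, HasDerivAt s (-(√⟪diagMul a (γ t), γ t⟫_ℝ)⁻¹) t := fun t ht => by
      rw [← hrate t ht]; exact hs t ht
    obtain ⟨hopen, hord, g, hg, hgC, hgd⟩ :=
      exists_inverse_time hc.isOpen hc.ordConnected hs' hsmooth hneg
    have hmaps : Set.MapsTo g (s '' I) I := by
      rintro _ ⟨t, ht, rfl⟩; rw [hg t ht]; exact ht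
    have hcomp {F : ℝ → E n} {V : E n} {t : ℝ} (ht : t ∈ I)
        (hF : HasDerivAt F (-(√⟪diagMul a (γ t), γ t⟫_ℝ)⁻¹ • V) t) :
        HasDerivAt (fun u => F (g u)) V (s t) := by
      have hF' : HasDerivAt F (-(√⟪diagMul a (γ t), γ t⟫_ℝ)⁻¹ • V) (g (s t)) := by
        rw [hg t ht]; exact hF
      refine (hF'.scomp (s t) (hgd t ht)).congr_deriv ?_
      rw [smul_smul, inv_mul_cancel₀ (hneg t ht).ne, one_smul]
    have hd1 (t : ℝ) (ht : t ∈ I) : deriv (fun u => sphereMap a (γ (g u))) (s t) =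
        neumannVelocity a γ t := (hcomp ht (hasDerivAt_sphereMap ha hc ht)).deriv
    refine ⟨fun u => sphereMap a (γ (g u)), fun t ht => by simp only [hg t ht],
      ⟨⟨hopen, hord, ?_, ?_⟩, ?_⟩, ?_⟩
    · exact (contDiffOn_sphereMap ha hc).comp hgC hmaps
    · intro u hu
      exact norm_sphereMap ha (ne_zero_of_norm_eq_one (hc.norm_eq_one _ (hmaps hu)))
    · rintro _ ⟨t, ht, rfl⟩ ξ hξ
      obtain ⟨r, hr⟩ := hasDerivAt_neumannVelocity ha h ht (hE t ht)
      have hev : deriv (fun u => sphereMap a (γ (g u))) =ᶠ[nhds (s t)]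
          fun u => neumannVelocity a γ (g u) := by
        filter_upwards [hopen.mem_nhds ⟨t, ht, rfl⟩]
        rintro _ ⟨τ, hτ, rfl⟩
        rw [hd1 τ hτ, hg τ hτ]
      rw [hev.deriv_eq, (hcomp ht hr).deriv, gradient_neumannPotential]
      simp only [hg t ht] at hξ ⊢
      simp only [inner_add_left, inner_smul_left, conj_trivial, hξ]
      ring
    · rintro _ ⟨t, ht, rfl⟩
      rw [hd1 t ht, norm_sq_neumannVelocity ha hc ht, hE t ht, neumannPotential]
      simp only [hg t ht]
      rw [invForm_sphereMap ha (hc.norm_eq_one t ht)]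
      ring

end RubberBall

end

theorem theorem5p2 (n : ℕ) (hn : 2 ≤ n) (m σ ρ : ℝ) (hm : 0 < m) (hσ : 0 < σ) (hρ : ρ = 2 * σ)
    (a : Fin n → ℝ) (ha : ∀ i, 0 < a i)
    (J : RubberBall.so n →ₗ[ℝ] RubberBall.so n)
    (hJ : ∀ i j : Fin n, J (RubberBall.wedge (RubberBall.basisVec i) (RubberBall.basisVec j)) =
      (a i * a j - m * ρ ^ 2) •
        RubberBall.wedge (RubberBall.basisVec i) (RubberBall.basisVec j)) :
    -- the reduced system takes the special form
    (∀ (γ : ℝ → RubberBall.E n) (I : Set ℝ),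
      RubberBall.IsReducedMotion (RubberBall.radiiRatio σ ρ) (RubberBall.totalInertia m ρ J) γ I ↔
        RubberBall.IsSpecialMotion (RubberBall.radiiRatio σ ρ) a γ I) ∧
    -- complete integrability
    RubberBall.CompletelyIntegrable (RubberBall.radiiRatio σ ρ)
      (RubberBall.totalInertia m ρ J) ∧
    -- unit-kinetic-energy motions become zero-energy trajectories of the Neumann system
    (∀ (γ : ℝ → RubberBall.E n) (I : Set ℝ),
      RubberBall.IsSpecialMotion (RubberBall.radiiRatio σ ρ) a γ I →
      (∀ t ∈ I, 1 / 2 * RubberBall.reducedMetric (RubberBall.radiiRatio σ ρ)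
        (RubberBall.totalInertia m ρ J) (γ t) (deriv γ t) (deriv γ t) = 1) →
      (∃ s : ℝ → ℝ, ∀ t ∈ I,
        HasDerivAt s (-√(RubberBall.invForm a (RubberBall.sphereMap a (γ t)))) t) ∧
      ∀ s : ℝ → ℝ, (∀ t ∈ I,
        HasDerivAt s (-√(RubberBall.invForm a (RubberBall.sphereMap a (γ t)))) t) →
        ∃ x : ℝ → RubberBall.E n,
          (∀ t ∈ I, x (s t) = RubberBall.sphereMap a (γ t)) ∧
          RubberBall.IsNaturalTrajectory (RubberBall.neumannPotential a) x (s '' I) ∧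
          ∀ u ∈ s '' I,
            1 / 2 * ‖deriv x u‖ ^ 2 + RubberBall.neumannPotential a (x u) = 0) := by
  have hI := RubberBall.totalInertia_wedge hJ
  have hε : RubberBall.radiiRatio σ ρ = -1 := by
    rw [RubberBall.radiiRatio, hρ, div_eq_iff (by linarith)]; ring
  rw [hε]
  refine ⟨RubberBall.isReducedMotion_iff_isSpecialMotion hI (-1),
    ⟨RubberBall.chaplyginMultiplier a, RubberBall.hamiltonian a,
      RubberBall.isHamiltonization_hamiltonian ha hI,
      RubberBall.liouvilleIntegrable_hamiltonian hn ha⟩,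
    fun γ I h hE => h.neumann ha fun t ht => ?_⟩
  have h1 := hE t ht
  rw [RubberBall.reducedMetric, RubberBall.reducedFlat_neg_one hI, inner_sub_left, inner_smul_left,
    inner_smul_left, conj_trivial, conj_trivial] at h1
  linarith
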